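/- Let $n\ge 1$ and $[n-1]=\{1,\dots,n-1\}$. A permutation $\pi$ of $[n-1]$ is a \emph{Baxter permutation} if there are no indices $i<j$, $j+1<k$ with $\pi_{j+1}<\pi_i<\pi_k<\pi_j$ or $\pi_{j+1}>\pi_i>\pi_k>\pi_j$. For a word $w$ with distinct entries, the tree $\mathrm{Max}(w)$ is a single leaf if $w$ is empty; otherwise $w=w_1\,z\,w_2$ with $z$ the maximum entry, and $\mathrm{Max}(w)$ has a root with left subtree $\mathrm{Max}(w_1)$ and right subtree $\mathrm{Max}(w_2)$. The tree $\mathrm{Min}(w)$ is defined in the same way with the minimum entry, and $\rho(w)$ is the reverse of $w$. The trees are regarded as unlabelled full binary trees. The \emph{reduced fingerprint} $\hat\alpha(A)$ of a full binary tree $A$ is the $0,1$ string that records for the leaves of $A$ from left to right, omitting the first and the last leaf, whether the leaf is a left child ($1$) or a right child ($0$). A pair $(S,T)$ of full binary trees with $n$ leaves each is a \emph{twin pair} if $\hat\alpha(S)=\rho(\hat\alpha(T))$. \emph{Associated rectangulation.} Put $N=n-1$. Place the leaves $0,1,\dots,N$ of $S$ at the points $(i,N-i)$, place each inner vertex with leftmost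 descendant leaf $i$ and rightmost descendant leaf $j$ at $(j,N-i)$, and draw the edges as axis-parallel segments. Draw $T$ in the same way and rotate it by a half-turn about the centre of $[0,N]^2$. The union of both drawings subdivides the square $[0,N]^2$ into rectangles. Tilt the picture so that the line $x+y=N$ becomes the horizontal axis (with $x$ increasing from left to right), heights being measured by $x+y$. The \emph{north-corner} and \emph{south-corner} of a rectangle are its highest and lowest corner. \emph{Pyramid-labelling algorithm.} Label the rectangles with $n-1,n-2,\dots,1$, in this order. The first label goes to the rectangle with the highest north-corner. At every later stage the unlabelled rectangles form \emph{pyramids}, the maximal sets of unlabelled rectangles that are not separated along the axis by a labelled rectangle; the \emph{tip} of a pyramid is the highest north-corner of its rectangles. If $R$ is the rectangle labelled last, then the next label goes to the rectangle whose north-corner is the tip of the next pyramid to the left of $R$ if the south-corner of $R$ is a left child in $T$, and to the rectangle whose north-corner is the tip of the next pyramid to the right of $R$ if the south-corner of $R$ is a right child in $T$. When all rectangles are labelled, the output is the sequence of the labels in the order in which the rectangles meet the axis from left to right. \textbf{Theorem.} The map $\pi\mapsto(\mathrm{Max}(\pi),\mathrm{Min}(\rho(\pi)))$ restricts to a bijection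 from the set of Baxter permutations of $[n-1]$ onto the set of twin pairs of binary trees with $n$ leaves. For every twin pair $(S,T)$ of binary trees with $n$ leaves, the pyramid-labelling algorithm on the rectangulation associated with $(S,T)$ has exactly one admissible choice at every step as long as some rectangle is unlabelled, and its output is the unique Baxter permutation $\pi$ with $(\mathrm{Max}(\pi),\mathrm{Min}(\rho(\pi)))=(S,T)$; that is, the algorithm computes the inverse of this bijection. -/

import Mathlib

namespace TwinBaxter

/-! ### Permutations and their max- and min-trees -/

/-- One-line notation `π₁, π₂, …, πₘ` of a permutation of `[m] = {1, …, m}`.  The set `[m]` is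
modelled by `Fin m`, the element `v : Fin m` standing for the number `v + 1`. -/
def oneLine {m : ℕ} (π : Equiv.Perm (Fin m)) : List ℕ :=
  List.ofFn fun i => (π i : ℕ) + 1

/-- Baxter permutations: there are no indices `i < j`, `j + 1 < k` with
`π_{j+1} < π_i < π_k < π_j` (pattern 2-41-3) or `π_{j+1} > π_i > π_k > π_j` (pattern 3-14-2).
Here `j'` is the index `j + 1`. -/
def IsBaxter {m : ℕ} (π : Equiv.Perm (Fin m)) : Prop :=
  ¬ ∃ i j j' k : Fin m, (j' : ℕ) = (j : ℕ) + 1 ∧ i < j ∧ j' < k ∧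
    ((π j' < π i ∧ π i < π k ∧ π k < π j) ∨ (π j' > π i ∧ π i > π k ∧ π k > π j))

theorem length_take_idxOf_lt {l : List ℕ} {z : ℕ} (h : z ∈ l) :
    (l.take (l.idxOf z)).length < l.length := by
  have := List.idxOf_lt_length_iff.2 h
  simp only [List.length_take]
  omega

theorem length_drop_idxOf_lt {l : List ℕ} {z : ℕ} (h : z ∈ l) :
    (l.drop (l.idxOf z + 1)).length < l.length := by
  have := List.idxOf_lt_length_iff.2 h
  simp only [List.length_drop]
  omega

/-- The max-tree of a word: the empty word gives an (unlabelled) leaf, and `left, z, right` with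
maximum entry `z` gives a root labelled `z` with subtrees `Max(left)` and `Max(right)`. -/
def maxTree (l : List ℕ) : BinaryTree ℕ :=
  match h : l.max? with
  | none => .nil
  | some z =>
    have hz : z ∈ l := List.max?_mem h
    .node z (maxTree (l.take (l.idxOf z))) (maxTree (l.drop (l.idxOf z + 1)))
termination_by l.length
decreasing_by
  · exact length_take_idxOf_lt hz
  · exact length_drop_idxOf_lt hz

/-- The min-tree of a word, defined dually with the minimum entry as the root label. -/
def minTree (l : List ℕ) : BinaryTree ℕ :=
  match h : l.min? with
  | none => .nil
  | some z =>
    have hz : z ∈ l := List.min?_mem h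
    .node z (minTree (l.take (l.idxOf z))) (minTree (l.drop (l.idxOf z + 1)))
termination_by l.length
decreasing_by
  · exact length_take_idxOf_lt hz
  · exact length_drop_idxOf_lt hz

/-! ### Full binary trees and twin pairs

A full binary tree is a term of `BinaryTree Unit`: `nil` is a leaf and `node () l r` is an inner
vertex with left child `l` and right child `r`. -/

/-- Forget the labels of the inner vertices. -/
def shape (T : BinaryTree ℕ) : BinaryTree Unit :=
  T.map fun _ => ()

/-- The map `π ↦ (Max(π), Min(ρ(π)))`, where `ρ(π)` is the reverse word of `π`. -/
def treePair {m : ℕ} (π : Equiv.Perm (Fin m)) : BinaryTree Unit × BinaryTree Unit :=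
  (shape (maxTree (oneLine π)), shape (minTree (oneLine π).reverse))

/-- For each leaf from left to right, is it a left child?  The flag `b` tells whether the root of
the tree is itself a left child in a larger tree. -/
def leafMarks : Bool → BinaryTree Unit → List Bool
  | b, .nil => [b]
  | _, .node _ l r => leafMarks true l ++ leafMarks false r

/-- The fingerprint, with `true` for the entry `1` (left leaf) and `false` for `0` (right leaf). -/
def fingerprint (T : BinaryTree Unit) : List Bool :=
  leafMarks false T

/-- The fingerprint without its first and its last entry. -/
def reducedFingerprint (T : BinaryTree Unit) : List Bool :=
  (fingerprint T).tail.dropLast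

/-- Twin pairs of (full) binary trees with `n` leaves each. -/
def twinPairs (n : ℕ) : Set (BinaryTree Unit × BinaryTree Unit) :=
  {p | p.1.numLeaves = n ∧ p.2.numLeaves = n ∧
    reducedFingerprint p.1 = (reducedFingerprint p.2).reverse}

/-! ### The rectangulation associated with a twin pair

We use axis-aligned coordinates in the square `[0, N]²`, where `N + 1` is the number of leaves.
The `i`-th leaf of `S` (counted from `0`) is at the point `(i, N - i)`.  An inner vertex of `S` whose
leftmost and rightmost descendant leaves are the `i`-th and the `j`-th is at `(j, N - i)`, and every
edge is a horizontal or vertical segment.  The tree `T` is drawn in the same way and then rotated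
by a half-turn about the centre of the square.

In the tilted picture (rotate by 45 degrees counterclockwise) the diagonal `x + y = N` becomes the
horizontal axis, oriented by increasing `x`, and the height of a point is given by `x + y`. -/

/-- Position of the root of the subtree `T` whose leftmost leaf is the `a`-th leaf of the whole
tree. Its rightmost leaf is the leaf with number `a + T.numNodes`. -/
def apex (N : ℝ) (a : ℕ) (T : BinaryTree Unit) : ℝ × ℝ :=
  ((a : ℝ) + (T.numNodes : ℝ), N - (a : ℝ))

/-- The union of the segments representing the edges of a tree. -/
def drawing (N : ℝ) : ℕ → BinaryTree Unit → Set (ℝ × ℝ)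
  | _, .nil => ∅
  | a, .node u l r =>
    segment ℝ (apex N a (.node u l r)) (apex N a l) ∪
      segment ℝ (apex N a (.node u l r)) (apex N (a + l.numLeaves) r) ∪
      (drawing N a l ∪ drawing N (a + l.numLeaves) r)

/-- The half-turn about the centre of the square `[0, N]²`. -/
def halfTurn (N : ℝ) (p : ℝ × ℝ) : ℝ × ℝ :=
  (N - p.1, N - p.2)

/-- The role of an inner vertex in its tree. -/
inductive Role
  | root
  | leftChild
  | rightChild

/-- The inner vertices of a tree, each with its role and its position in the drawing. -/
def innerVertices (N : ℝ) : Role → ℕ → BinaryTree Unit → Set (Role × (ℝ × ℝ))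
  | _, _, .nil => ∅
  | κ, a, .node u l r =>
    {(κ, apex N a (.node u l r))} ∪
      (innerVertices N .leftChild a l ∪ innerVertices N .rightChild (a + l.numLeaves) r)

/-- Side length of the square that belongs to a pair of trees whose first member is `S`. -/
def side (S : BinaryTree Unit) : ℝ :=
  (S.numNodes : ℝ)

/-- The drawing of the pair `(S, T)`: the tree `S` glued to the rotated tree `T`. -/
def gluedDrawing (S T : BinaryTree Unit) : Set (ℝ × ℝ) :=
  drawing (side S) 0 S ∪ halfTurn (side S) '' drawing (side S) 0 T

/-- An axis-aligned rectangle, given by its south-corner (lower left, lowest in the tilted picture)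
and its north-corner (upper right, highest in the tilted picture). -/
structure Box where
  south : ℝ × ℝ
  north : ℝ × ℝ

/-- The points of a rectangle. -/
def Box.toSet (B : Box) : Set (ℝ × ℝ) :=
  Set.Icc B.south B.north

/-- The rectangles into which the segments of the glued drawing subdivide the square: the
non-degenerate rectangles whose boundary is drawn and whose interior contains no drawn point. -/
def rectangles (S T : BinaryTree Unit) : Set Box :=
  {B | B.south.1 < B.north.1 ∧ B.south.2 < B.north.2 ∧
    frontier B.toSet ⊆ gluedDrawing S T ∧ Disjoint (interior B.toSet) (gluedDrawing S T)}

/-- Height of a point in the tilted picture. -/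
def height (p : ℝ × ℝ) : ℝ :=
  p.1 + p.2

/-- The part of the diagonal `x + y = N` (the horizontal axis of the tilted picture) that belongs
to a rectangle, parametrized by `x`. -/
def axisInterval (N : ℝ) (B : Box) : Set ℝ :=
  {x | (x, N - x) ∈ B.toSet}

/-- `B` meets the axis to the left of `C`. -/
def LeftOf (N : ℝ) (B C : Box) : Prop :=
  ∀ x ∈ axisInterval N B, ∀ y ∈ axisInterval N C, x ≤ y

/-- The south-corner of `R` is an inner vertex of `T` with role `κ`. -/
def SouthCornerIs (S T : BinaryTree Unit) (κ : Role) (R : Box) : Prop :=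
  (κ, halfTurn (side S) R.south) ∈ innerVertices (side S) .root 0 T

/-! ### The pyramid-labelling algorithm

A state is the list `L` of the rectangles that carry a label, the most recently labelled one first.
The labels are given out in the order `n - 1, n - 2, …, 1`. -/

/-- The unlabelled rectangles. -/
def unlabelled (S T : BinaryTree Unit) (L : List Box) : Set Box :=
  {B | B ∈ rectangles S T ∧ B ∉ L}

/-- The pyramid that contains the unlabelled rectangle `B`: all unlabelled rectangles that are not
separated from `B`, along the axis, by a labelled one. -/
def pyramid (S T : BinaryTree Unit) (L : List Box) (B : Box) : Set Box :=
  {C | C ∈ unlabelled S T L ∧ ∀ X ∈ L,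
    ¬ (LeftOf (side S) B X ∧ LeftOf (side S) X C) ∧
    ¬ (LeftOf (side S) C X ∧ LeftOf (side S) X B)}

/-- `B` is unlabelled and its north-corner is the tip of its pyramid. -/
def IsTip (S T : BinaryTree Unit) (L : List Box) (B : Box) : Prop :=
  B ∈ unlabelled S T L ∧ ∀ C ∈ pyramid S T L B, height C.north ≤ height B.north

/-- The pyramid of `B` is the next pyramid to the left of `R`. -/
def InNextLeft (S T : BinaryTree Unit) (L : List Box) (R B : Box) : Prop :=
  LeftOf (side S) B R ∧ ∀ C ∈ unlabelled S T L,
    LeftOf (side S) B C → LeftOf (side S) C R → C ∈ pyramid S T L B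

/-- The pyramid of `B` is the next pyramid to the right of `R`. -/
def InNextRight (S T : BinaryTree Unit) (L : List Box) (R B : Box) : Prop :=
  LeftOf (side S) R B ∧ ∀ C ∈ unlabelled S T L,
    LeftOf (side S) R C → LeftOf (side S) C B → C ∈ pyramid S T L B

/-- The labelling rule: in state `L`, the next label may be given to `B`.  The first label goes to
the rectangle with the highest north-corner.  If `R` was labelled last, then the next label goes to
the rectangle at the tip of the next pyramid to the left of `R` if the south-corner of `R` is a left
child in `T`, and of the next pyramid to the right of `R` if it is a right child in `T`. -/
def Step (S T : BinaryTree Unit) : List Box → Box → Prop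
  | [], B => B ∈ rectangles S T ∧ ∀ C ∈ rectangles S T, height C.north ≤ height B.north
  | R :: L, B => IsTip S T (R :: L) B ∧
      ((SouthCornerIs S T .leftChild R ∧ InNextLeft S T (R :: L) R B) ∨
        (SouthCornerIs S T .rightChild R ∧ InNextRight S T (R :: L) R B))

/-- The states that the algorithm can reach. -/
inductive Reachable (S T : BinaryTree Unit) : List Box → Prop
  | start : Reachable S T []
  | step {L : List Box} {B : Box} :
      Reachable S T L → Step S T L B → Reachable S T (B :: L)

/-- `π` is the permutation read off from the final state `L`: since `L` lists the rectangles with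
labels `1, 2, …, m` in this order, the entry of `L` at (zero-based) place `π i` is the rectangle
with label `(π i : ℕ) + 1`; the rectangles are met on the axis from left to right in the order
`π₁, …, πₘ` of their labels. -/
def ReadsOff {m : ℕ} (N : ℝ) (L : List Box) (π : Equiv.Perm (Fin m)) : Prop :=
  ∃ h : L.length = m, ∀ i j : Fin m, i < j →
    LeftOf N (L.get (Fin.cast h.symm (π i))) (L.get (Fin.cast h.symm (π j)))

/-- The algorithm, applied to the rectangulation of `(S, T)`, can label all rectangles in such a
way that the permutation `π` results. -/
def PyramidOutput {m : ℕ} (S T : BinaryTree Unit) (π : Equiv.Perm (Fin m)) : Prop :=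
  ∃ L : List Box, Reachable S T L ∧ unlabelled S T L = ∅ ∧ ReadsOff (side S) L π

end TwinBaxter

/-! Put `N = n - 1`. Leaf `i` sits in the gap between the positions `i` and `i + 1` of a word, and
the inner vertices are the positions themselves. A max-tree depends only on which positions dominate
which stretches of the word (`Dominates`), and leaf `i` is a left child exactly at a descent from
`i` to `i + 1`. Hence a pair of trees is twin iff the words behind the two trees have the same
descents (`mem_twinPairs_iff`).

Surjectivity: realise `S` and `T` by two unrelated words `f` and `g`. Since their descents agree,
they can be merged into one Baxter word with the maxima structure of `f` and the minima structure of
`g` (`exists_baxterWord`, by induction on the position of the largest value of `f`).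

Algorithm: let the pair come from a permutation. Its rectangles are cells, one for each position
`k`, spanned by the vertex `k` of `T` at the south and the vertex `k` of `S` at the north; the cell
of `k` meets the axis in `[k - 1, k]` (`mem_rectangles_iff`, `axisInterval_cell`). A north-corner is
the higher the more leaves lie below its vertex, so within a run of positions the largest value has
the highest one. After the values above `v` have been placed, the pyramids are therefore the maximal
runs of values at most `v`, and their tips are the run maxima. The Baxter condition puts `v` into
the run next to `v + 1`, and the same condition makes the side of `v` readable from the role of the
south-corner of `v + 1` in `T`. So the label `v` is forced onto its own cell (`step_iff`).

Injectivity is a by-product: the algorithm sees only `(S, T)`, yet returns the permutation. -/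

namespace TwinBaxter

/-! ### Max-trees of words and domination -/

/-- `A` is the shape of the max-tree of the word `f (a + 1), …, f b`. -/
inductive IsMaxTree (f : ℕ → ℤ) : ℕ → ℕ → BinaryTree Unit → Prop
  | nil (a : ℕ) : IsMaxTree f a a .nil
  | node {a k b : ℕ} {l r : BinaryTree Unit} (hak : a ≤ k) (hkb : k < b)
      (hmax : ∀ m, a < m → m ≤ b → m ≠ k + 1 → f m < f (k + 1))
      (hl : IsMaxTree f a k l) (hr : IsMaxTree f (k + 1) b r) :
      IsMaxTree f a b (.node () l r)

/-- The value at `i` dominates all values between `i` and `j`. -/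
def Dominates (f : ℕ → ℤ) (i j : ℕ) : Prop :=
  ∀ m, (i ≤ m ∧ m ≤ j ∨ j ≤ m ∧ m ≤ i) → m ≠ i → f m < f i

theorem IsMaxTree.eq_add_numNodes {f : ℕ → ℤ} {a b : ℕ} {A : BinaryTree Unit}
    (h : IsMaxTree f a b A) : b = a + A.numNodes := by
  induction h with
  | nil a => simp
  | node hak hkb _ _ _ ihl ihr => simp only [BinaryTree.numNodes]; omega

/-- The root is the position that dominates the whole interval, and recursively so in the subtrees;
the actual values never enter. This is how trees of different words are compared. -/
theorem IsMaxTree.congr {f f' : ℕ → ℤ} {a b : ℕ} {A : BinaryTree Unit}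
    (h : IsMaxTree f a b A)
    (hff : ∀ i j, a < i → i ≤ b → a < j → j ≤ b → (Dominates f i j ↔ Dominates f' i j)) :
    IsMaxTree f' a b A := by
  induction h with
  | nil a => exact .nil a
  | @node a k b l r hak hkb hmax hl hr ihl ihr =>
    refine .node hak hkb (fun m h1 h2 h3 => ?_)
      (ihl fun i j h1 h2 h3 h4 => hff i j h1 (by omega) h3 (by omega))
      (ihr fun i j h1 h2 h3 h4 => hff i j (by omega) h2 (by omega) h4)
    have := (hff (k + 1) m (by omega) (by omega) h1 h2).1
      (fun m' h h' => hmax m' (by omega) (by omega) h')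
    exact this m (by omega) h3

theorem IsMaxTree.unique {f : ℕ → ℤ} {a b : ℕ} {A B : BinaryTree Unit}
    (h : IsMaxTree f a b A) (h' : IsMaxTree f a b B) : A = B := by
  induction h generalizing B with
  | nil a =>
    cases h' with
    | nil => rfl
    | node => omega
  | @node a k b l r hak hkb hmax hl hr ihl ihr =>
    cases h' with
    | nil => omega
    | @node _ k' _ l' r' hak' hkb' hmax' hl' hr' =>
      obtain rfl : k = k' := by
        by_contra hne
        have h1 := hmax (k' + 1) (by omega) (by omega) (by omega)
        have h2 := hmax' (k + 1) (by omega) (by omega) (by omega)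
        omega
      rw [ihl hl', ihr hr']

/-- The left subtree receives the lowest block of values, the right subtree the next block, and the
root the top value. -/
theorem exists_isMaxTree (A : BinaryTree Unit) (a : ℕ) :
    ∃ f : ℕ → ℤ, (∀ m, a < m → m ≤ a + A.numNodes → 0 ≤ f m ∧ f m < A.numNodes) ∧
      (∀ i j, a < i → i ≤ a + A.numNodes → a < j → j ≤ a + A.numNodes → f i = f j → i = j) ∧
      IsMaxTree f a (a + A.numNodes) A := by
  induction A generalizing a with
  | nil => exact ⟨fun _ => 0, by simp, by simp; omega, .nil a⟩
  | node u l r ihl ihr =>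
    obtain ⟨fl, hl1, hl2, hl3⟩ := ihl a
    obtain ⟨fr, hr1, hr2, hr3⟩ := ihr (a + l.numNodes + 1)
    have hb : a + (BinaryTree.node u l r).numNodes = a + l.numNodes + 1 + r.numNodes := by
      simp only [BinaryTree.numNodes]; omega
    have hc : ((BinaryTree.node u l r).numNodes : ℤ) = l.numNodes + r.numNodes + 1 := by
      simp only [BinaryTree.numNodes]; push_cast; ring
    rw [hb, hc]
    set k := a + l.numNodes with hk
    set f : ℕ → ℤ := fun m => if m ≤ k then fl m else if m = k + 1 then
      l.numNodes + r.numNodes else l.numNodes + fr m with hf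
    have f1 : ∀ m, m ≤ k → f m = fl m := fun m hm => by simp [hf, hm]
    have f2 : f (k + 1) = l.numNodes + r.numNodes := by simp [hf]
    have f3 : ∀ m, k + 1 < m → f m = l.numNodes + fr m := fun m hm => by
      simp only [hf]; rw [if_neg (by omega), if_neg (by omega)]
    have tri : ∀ m, m ≤ k ∨ m = k + 1 ∨ k + 1 < m := by intro m; omega
    have key : ∀ m, a < m → m ≤ k + 1 + r.numNodes →
        (m ≤ k → 0 ≤ f m ∧ f m < l.numNodes) ∧
        (k + 1 < m → l.numNodes ≤ f m ∧ f m < l.numNodes + r.numNodes) := by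
      intro m h1 h2
      refine ⟨fun h => ?_, fun h => ?_⟩
      · rw [f1 m h]; exact hl1 m h1 h
      · have := hr1 m h h2
        rw [f3 m h]; omega
    refine ⟨f, ?_, ?_, ?_⟩
    · intro m h1 h2
      have := key m h1 h2
      rcases tri m with h | rfl | h <;> omega
    · intro i j h1 h2 h3 h4 h5
      have ki := key i h1 h2
      have kj := key j h3 h4
      rcases tri i with h | rfl | h <;> rcases tri j with h' | rfl | h' <;> try omega
      · rw [f1 i h, f1 j h'] at h5
        exact hl2 i j h1 h h3 h' h5
      · rw [f3 i h, f3 j h'] at h5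
        exact hr2 i j h h2 h' h4 (by omega)
    · refine .node (k := k) (by omega) (by omega) ?_ ?_ ?_
      · intro m h1 h2 h3
        have := key m h1 h2
        rcases tri m with h | rfl | h <;> omega
      · refine hl3.congr fun i j h1 h2 h3 h4 => ?_
        refine forall₃_congr fun m h h' => ?_
        rw [f1 m (by omega), f1 i (by omega)]
      · refine hr3.congr fun i j h1 h2 h3 h4 => ?_
        refine forall₃_congr fun m h h' => ?_
        rw [f3 m (by omega), f3 i (by omega)]
        omega

theorem isMaxTree_maxTree (l : List ℕ) (hl : l.Nodup) (f : ℕ → ℤ) (a : ℕ)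
    (hf : ∀ i (h : i < l.length), f (a + i + 1) = l[i]) :
    IsMaxTree f a (a + l.length) (shape (maxTree l)) := by
  induction hn : l.length using Nat.strong_induction_on generalizing l a with
  | _ n ih =>
    subst hn
    rw [maxTree]
    split
    · next h =>
      rw [List.max?_eq_none_iff] at h
      subst h
      exact .nil a
    · next z h =>
      have hz : z ∈ l := List.max?_mem h
      have hi := List.idxOf_lt_length_iff.2 hz
      have hzi : l[l.idxOf z] = z := List.getElem_idxOf hi
      have hfz := hf _ hi
      rw [hzi] at hfz
      have h1 := ih _ (length_take_idxOf_lt hz) (l.take (l.idxOf z))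
        (hl.sublist (List.take_sublist _ _)) a (fun i h => by
          rw [hf i (by simp at h; omega), List.getElem_take]) rfl
      have h2 := ih _ (length_drop_idxOf_lt hz) (l.drop (l.idxOf z + 1))
        (hl.sublist (List.drop_sublist _ _)) (a + l.idxOf z + 1) (fun i h => by
          rw [List.getElem_drop, ← hf _ (by simp at h; omega)]
          congr 1; omega) rfl
      refine .node (k := a + l.idxOf z) (by omega) (by omega) ?_ ?_ ?_
      · intro m hm1 hm2 hm3
        obtain ⟨i, rfl⟩ : ∃ i, m = a + i + 1 := ⟨m - a - 1, by omega⟩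
        rw [hf i (by omega), hfz]
        have hle : l[i] ≤ z := (List.max?_eq_some_iff.1 h).2 _ (List.getElem_mem _)
        have hne : l[i] ≠ z := fun he => hm3 (by
          have := (hl.getElem_inj_iff (hi := by omega) (hj := hi)).1 (he.trans hzi.symm)
          omega)
        omega
      · convert h1 using 1
        · simp; omega
        · rfl
      · convert h2 using 1
        · simp; omega
        · rfl

/-- Negation turns minima into maxima, so only one kind of tree has to be analysed. -/
theorem isMaxTree_minTree (l : List ℕ) (hl : l.Nodup) (f : ℕ → ℤ) (a : ℕ)
    (hf : ∀ i (h : i < l.length), f (a + i + 1) = -l[i]) :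
    IsMaxTree f a (a + l.length) (shape (minTree l)) := by
  induction hn : l.length using Nat.strong_induction_on generalizing l a with
  | _ n ih =>
    subst hn
    rw [minTree]
    split
    · next h =>
      rw [List.min?_eq_none_iff] at h
      subst h
      exact .nil a
    · next z h =>
      have hz : z ∈ l := List.min?_mem h
      have hi := List.idxOf_lt_length_iff.2 hz
      have hzi : l[l.idxOf z] = z := List.getElem_idxOf hi
      have hfz := hf _ hi
      rw [hzi] at hfz
      have h1 := ih _ (length_take_idxOf_lt hz) (l.take (l.idxOf z))
        (hl.sublist (List.take_sublist _ _)) a (fun i h => by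
          rw [hf i (by simp at h; omega), List.getElem_take]) rfl
      have h2 := ih _ (length_drop_idxOf_lt hz) (l.drop (l.idxOf z + 1))
        (hl.sublist (List.drop_sublist _ _)) (a + l.idxOf z + 1) (fun i h => by
          rw [List.getElem_drop, ← hf _ (by simp at h; omega)]
          congr 1; omega) rfl
      refine .node (k := a + l.idxOf z) (by omega) (by omega) ?_ ?_ ?_
      · intro m hm1 hm2 hm3
        obtain ⟨i, rfl⟩ : ∃ i, m = a + i + 1 := ⟨m - a - 1, by omega⟩
        rw [hf i (by omega), hfz]
        have hle : z ≤ l[i] := (List.min?_eq_some_iff.1 h).2 _ (List.getElem_mem _)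
        have hne : l[i] ≠ z := fun he => hm3 (by
          have := (hl.getElem_inj_iff (hi := by omega) (hj := hi)).1 (he.trans hzi.symm)
          omega)
        omega
      · convert h1 using 1
        · simp; omega
        · rfl
      · convert h2 using 1
        · simp; omega
        · rfl

/-! ### Fingerprints are descent sets -/

/-- Leaf `i` hangs below the smaller of its neighbours `i` and `i + 1`, and it is a left child when
that is `i + 1`. Border values above the whole word keep this true at both ends; `κ` matters only if
the tree is a single leaf. -/
theorem leafMarks_eq_map {f : ℕ → ℤ} {a b : ℕ} {A : BinaryTree Unit} (h : IsMaxTree f a b A)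
    (hf : ∀ m, a < m → m ≤ b → f m < f a ∧ f m < f (b + 1)) (κ : Bool)
    (hκ : a = b → κ = decide (f (a + 1) < f a)) :
    leafMarks κ A = (List.range' a (b + 1 - a)).map fun i => decide (f (i + 1) < f i) := by
  induction h generalizing κ with
  | nil a => simp [leafMarks, hκ rfl]
  | @node a k b l r hak hkb hmax hl hr ihl ihr =>
    rw [leafMarks, ihl, ihr, ← List.map_append]
    · congr 1
      have : b + 1 - a = (k + 1 - a) + (b + 1 - (k + 1)) := by omega
      rw [this, ← List.range'_append_1]
      congr 2
      omega
    · exact fun m h1 h2 => ⟨hmax m (by omega) h2 (by omega), (hf m (by omega) h2).2⟩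
    · rintro rfl
      have := hf (k + 1) (by omega) (by omega)
      simp only [false_eq_decide_iff]; omega
    · exact fun m h1 h2 => ⟨(hf m h1 (by omega)).1, hmax m h1 (by omega) (by omega)⟩
    · rintro rfl
      simp [(hf (a + 1) (by omega) (by omega)).1]

theorem reducedFingerprint_eq_map {f : ℕ → ℤ} {N : ℕ} {A : BinaryTree Unit}
    (h : IsMaxTree f 0 N A) :
    reducedFingerprint A = (List.range' 1 (N - 1)).map fun i => decide (f (i + 1) < f i) := by
  have hN : ∃ M : ℤ, ∀ m ≤ N, f m < M := by
    obtain ⟨M, hM⟩ := ((Set.finite_Iic N).image f).bddAbove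
    exact ⟨M + 1, fun m hm => by have := hM ⟨m, hm, rfl⟩; omega⟩
  obtain ⟨M, hM⟩ := hN
  -- The two end leaves are dropped, so the values outside `[1, N]` may be replaced by a common
  -- strict upper bound.
  set f' : ℕ → ℤ := fun m => if 1 ≤ m ∧ m ≤ N then f m else M
  have e : ∀ m, 1 ≤ m → m ≤ N → f' m = f m := fun m h1 h2 => if_pos ⟨h1, h2⟩
  have e0 : f' 0 = M := if_neg (by omega)
  have e1 : f' (N + 1) = M := if_neg (by omega)
  have h' : IsMaxTree f' 0 N A := h.congr fun i j h1 h2 h3 h4 =>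
    forall₃_congr fun m h h' => by rw [e m (by omega) (by omega), e i h1 h2]
  have key := leafMarks_eq_map h' (fun m h1 h2 => by rw [e m h1 h2, e0, e1]; simp [hM m h2])
    false (by rintro rfl; simp [e0, e1])
  rw [reducedFingerprint, fingerprint, key]
  cases N with
  | zero => simp
  | succ N =>
    rw [show N + 1 + 1 - 0 = 1 + N + 1 by omega, ← List.range'_append_1,
      ← List.range'_append_1]
    simp only [List.map_append, List.range'_one, List.map_cons, List.map_nil,
      List.cons_append, List.nil_append, List.tail_cons, List.dropLast_concat]
    refine List.map_congr_left fun i hi => ?_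
    simp only [List.mem_range'_1] at hi
    rw [e i (by omega) (by omega), e (i + 1) (by omega) (by omega)]

/-! ### Edges and vertices of the drawing in terms of the word -/

/-- Descending to left children keeps the leftmost leaf `c`, so the edges with ordinate `N - c` form
one segment, which extends to the last `d` such that position `c` exceeds all of `c + 1, …, d`.
Vertical edges behave dually, with position `d + 1`. Admitting all pairs `c < d`, not only the
maximal ones, lets the description pass to subtrees. -/
theorem mem_drawing_iff {f : ℕ → ℤ} {a b : ℕ} {A : BinaryTree Unit} (h : IsMaxTree f a b A)
    (hf : ∀ m, a < m → m ≤ b → f m < f a ∧ f m < f (b + 1)) (N : ℝ) (p : ℝ × ℝ) :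
    p ∈ drawing N a A ↔ ∃ c d : ℕ, a ≤ c ∧ c < d ∧ d ≤ b ∧
      (((∀ m, c < m → m ≤ d → f m < f c) ∧ p.2 = N - c ∧ (c : ℝ) ≤ p.1 ∧ p.1 ≤ d) ∨
       ((∀ m, c < m → m ≤ d → f m < f (d + 1)) ∧ p.1 = d ∧ N - d ≤ p.2 ∧ p.2 ≤ N - c)) := by
  induction h with
  | nil a =>
    simp only [drawing, Set.mem_empty_iff_false, false_iff]
    rintro ⟨c, d, h⟩; omega
  | @node a k b l r hak hkb hmax hl hr ihl ihr =>
    have el := hl.eq_add_numNodes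
    have er := hr.eq_add_numNodes
    have e1 : apex N a (.node () l r) = ((b : ℝ), N - a) := by
      have : b = a + (BinaryTree.node () l r).numNodes := by
        simp only [BinaryTree.numNodes]; omega
      rw [this, apex]; push_cast; rfl
    have e2 : apex N a l = ((k : ℝ), N - a) := by rw [el, apex]; push_cast; rfl
    have e3 : a + l.numLeaves = k + 1 := by
      rw [BinaryTree.numLeaves_eq_numNodes_succ]; omega
    have e4 : apex N (k + 1) r = ((b : ℝ), N - (k + 1 : ℕ)) := by
      rw [er, apex]; push_cast; rfl
    have hkb' : (k : ℝ) ≤ b := by exact_mod_cast hkb.le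
    have hkb'' : ((k + 1 : ℕ) : ℝ) ≤ b := by exact_mod_cast hkb
    have hak' : (a : ℝ) ≤ k := by exact_mod_cast hak
    have hseg1 : p ∈ segment ℝ ((b : ℝ), N - (a : ℝ)) ((k : ℝ), N - a) ↔
        p.2 = N - a ∧ (k : ℝ) ≤ p.1 ∧ p.1 ≤ b := by
      rw [segment_symm, ← Prod.image_mk_segment_left, segment_eq_Icc hkb']
      constructor
      · rintro ⟨x, hx, rfl⟩; exact ⟨rfl, hx.1, hx.2⟩
      · rintro ⟨h1, h2, h3⟩; exact ⟨p.1, ⟨h2, h3⟩, by rw [← h1]⟩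
    have hseg2 : p ∈ segment ℝ ((b : ℝ), N - (a : ℝ)) ((b : ℝ), N - (k + 1 : ℕ)) ↔
        p.1 = b ∧ N - (k + 1 : ℕ) ≤ p.2 ∧ p.2 ≤ N - a := by
      rw [segment_symm, ← Prod.image_mk_segment_right,
        segment_eq_Icc (by push_cast; linarith)]
      constructor
      · rintro ⟨x, hx, rfl⟩; exact ⟨rfl, hx.1, hx.2⟩
      · rintro ⟨h1, h2, h3⟩; exact ⟨p.2, ⟨h2, h3⟩, by rw [← h1]⟩
    rw [drawing, e1, e2, e3, e4, Set.mem_union, Set.mem_union, Set.mem_union, hseg1, hseg2,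
      ihl fun m h1 h2 => ⟨(hf m h1 (by omega)).1, hmax m h1 (by omega) (by omega)⟩,
      ihr fun m h1 h2 => ⟨hmax m (by omega) h2 (by omega), (hf m (by omega) h2).2⟩]
    constructor
    · rintro ((⟨h1, h2, h3⟩ | ⟨h1, h2, h3⟩) | ⟨c, d, h1, h2, h3, h4⟩ | ⟨c, d, h1, h2, h3, h4⟩)
      · exact ⟨a, b, le_rfl, by omega, le_rfl,
          .inl ⟨fun m h1 h2 => (hf m h1 h2).1, h1, hak'.trans h2, h3⟩⟩
      · exact ⟨a, b, le_rfl, by omega, le_rfl,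
          .inr ⟨fun m h1 h2 => (hf m h1 h2).2, h1, by linarith, h3⟩⟩
      · exact ⟨c, d, h1, h2, by omega, h4⟩
      · exact ⟨c, d, by omega, h2, h3, h4⟩
    · rintro ⟨c, d, h1, h2, h3, h4⟩
      have hc1 : c ≤ k → (c : ℝ) ≤ k := fun h => by exact_mod_cast h
      have hdb : (d : ℝ) ≤ b := by exact_mod_cast h3
      have hac : (a : ℝ) ≤ c := by exact_mod_cast h1
      rcases h4 with ⟨h4, h5, h6, h7⟩ | ⟨h4, h5, h6, h7⟩
      · rcases Nat.lt_or_ge k c with hc | hc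
        · exact .inr (.inr ⟨c, d, hc, h2, h3, .inl ⟨h4, h5, h6, h7⟩⟩)
        rcases Nat.lt_or_ge k d with hd | hd
        -- A segment reaching past the root position needs a value above the root, which on the left
        -- only the border has. It is then cut at `x = k` into a root edge and a segment of `l`.
        · obtain rfl : c = a := by
            by_contra hne
            have := hmax c (by omega) (by omega) (by omega)
            have := h4 (k + 1) (by omega) (by omega)
            omega
          rcases le_total (k : ℝ) p.1 with hp | hp
          · exact .inl (.inl ⟨h5, hp, h7.trans hdb⟩)
          · rcases Nat.eq_or_lt_of_le hak with rfl | hak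
            · exact .inl (.inl ⟨h5, h6, h7.trans hdb⟩)
            exact .inr (.inl ⟨c, k, le_rfl, hak, le_rfl,
              .inl ⟨fun m h1 h2 => (hf m h1 (by omega)).1, h5, h6, hp⟩⟩)
        · exact .inr (.inl ⟨c, d, h1, h2, hd, .inl ⟨h4, h5, h6, h7⟩⟩)
      · rcases Nat.lt_or_ge k d with hd | hd
        · rcases Nat.lt_or_ge k c with hc | hc
          · exact .inr (.inr ⟨c, d, hc, h2, h3, .inr ⟨h4, h5, h6, h7⟩⟩)
          obtain rfl : d = b := by
            by_contra hne
            have := hmax (d + 1) (by omega) (by omega) (by omega)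
            have := h4 (k + 1) (by omega) (by omega)
            omega
          rcases le_total (N - (k + 1 : ℕ)) p.2 with hp | hp
          · exact .inl (.inr ⟨h5, hp, by linarith⟩)
          · rcases Nat.eq_or_lt_of_le (show k + 1 ≤ d from hkb) with rfl | hkb
            · exact .inl (.inr ⟨h5, h6, by linarith⟩)
            exact .inr (.inr ⟨k + 1, d, le_rfl, hkb, le_rfl,
              .inr ⟨fun m h1 h2 => (hf m (by omega) h2).2, h5, h6, hp⟩⟩)
        · exact .inr (.inl ⟨c, d, h1, h2, hd, .inr ⟨h4, h5, h6, h7⟩⟩)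

/-- The inner vertex at position `k` of the max-tree of `f` has the leaves `c, …, d`. -/
structure IsVertex (f : ℕ → ℤ) (c k d : ℕ) : Prop where
  lt : c < k
  le : k ≤ d
  max : ∀ m, c < m → m ≤ d → m ≠ k → f m < f k
  left : f k < f c
  right : f k < f (d + 1)

/-- The role of a proper descendant with leaves `c, …, d`. -/
def roleOf (f : ℕ → ℤ) (c d : ℕ) : Role :=
  if f (d + 1) < f c then .leftChild else .rightChild

/-- A proper subtree with leaves `c, …, d` hangs below the smaller of its bordering positions `c`
and `d + 1`, and it is a left child when that is `d + 1`. -/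
theorem mem_innerVertices_iff {f : ℕ → ℤ} {a b : ℕ} {A : BinaryTree Unit}
    (h : IsMaxTree f a b A)
    (hf : ∀ m, a < m → m ≤ b → f m < f a ∧ f m < f (b + 1)) (N : ℝ) (κ ρ : Role) (p : ℝ × ℝ) :
    (ρ, p) ∈ innerVertices N κ a A ↔ ∃ c k d : ℕ, a ≤ c ∧ d ≤ b ∧ IsVertex f c k d ∧
      p = ((d : ℝ), N - c) ∧ ρ = if c = a ∧ d = b then κ else roleOf f c d := by
  induction h generalizing κ with
  | nil a =>
    simp only [innerVertices, Set.mem_empty_iff_false, false_iff]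
    rintro ⟨c, k, d, h1, h2, h3, -⟩
    have := h3.lt
    have := h3.le
    omega
  | @node a k b l r hak hkb hmax hl hr ihl ihr =>
    have e1 : apex N a (.node () l r) = ((b : ℝ), N - a) := by
      have : b = a + (BinaryTree.node () l r).numNodes := by
        have el := hl.eq_add_numNodes
        have er := hr.eq_add_numNodes
        simp only [BinaryTree.numNodes]; omega
      rw [this, apex]; push_cast; rfl
    have e3 : a + l.numLeaves = k + 1 := by
      have el := hl.eq_add_numNodes
      rw [BinaryTree.numLeaves_eq_numNodes_succ]; omega
    have hk := hf (k + 1) (by omega) (by omega)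
    rw [innerVertices, e1, e3, Set.mem_union, Set.mem_union, Set.mem_singleton_iff,
      ihl fun m h1 h2 => ⟨(hf m h1 (by omega)).1, hmax m h1 (by omega) (by omega)⟩,
      ihr fun m h1 h2 => ⟨hmax m (by omega) h2 (by omega), (hf m (by omega) h2).2⟩]
    constructor
    · rintro (h | ⟨c, j, d, h1, h2, h3, h4, h5⟩ | ⟨c, j, d, h1, h2, h3, h4, h5⟩)
      · rw [Prod.mk.injEq] at h
        exact ⟨a, k + 1, b, le_rfl, le_rfl, ⟨by omega, hkb, hmax, hk.1, hk.2⟩, h.2, by simp [h.1]⟩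
      · refine ⟨c, j, d, h1, by omega, h3, h4, ?_⟩
        rw [h5, if_neg (show ¬ (c = a ∧ d = b) by omega)]
        split_ifs with h
        · rw [roleOf, if_pos (by rw [h.1, h.2]; exact hk.1)]
        · rfl
      · refine ⟨c, j, d, by omega, h2, h3, h4, ?_⟩
        rw [h5, if_neg (show ¬ (c = a ∧ d = b) by omega)]
        split_ifs with h
        · rw [roleOf, if_neg (by rw [h.1, h.2]; have := hk.2; omega)]
        · rfl
    · rintro ⟨c, j, d, h1, h2, h3, h4, h5⟩
      have hj1 := h3.lt
      have hj2 := h3.le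
      rcases Nat.lt_trichotomy j (k + 1) with hj | rfl | hj
      · have hd : d ≤ k := by
          by_contra hd
          have := h3.max (k + 1) (by omega) (by omega) (by omega)
          have := hmax j (by omega) (by omega) (by omega)
          omega
        refine .inr (.inl ⟨c, j, d, h1, hd, h3, h4, ?_⟩)
        rw [h5, if_neg (show ¬ (c = a ∧ d = b) by omega)]
        split_ifs with h
        · rw [roleOf, if_pos (by rw [h.1, h.2]; exact hk.1)]
        · rfl
      · obtain rfl : c = a := by
          by_contra hne
          have := hmax c (by omega) (by omega) (by omega)
          have := h3.left
          omega
        obtain rfl : d = b := by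
          by_contra hne
          have := hmax (d + 1) (by omega) (by omega) (by omega)
          have := h3.right
          omega
        left
        rw [h4, h5]; simp
      · have hc : k + 1 ≤ c := by
          by_contra hc
          have := h3.max (k + 1) (by omega) (by omega) (by omega)
          have := hmax j (by omega) (by omega) (by omega)
          omega
        refine .inr (.inr ⟨c, j, d, hc, h2, h3, h4, ?_⟩)
        rw [h5, if_neg (show ¬ (c = a ∧ d = b) by omega)]
        split_ifs with h
        · rw [roleOf, if_neg (by rw [h.1, h.2]; have := hk.2; omega)]
        · rfl

/-! ### Merging two words with equal ascents into a Baxter word -/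

/-- The value at `i` is smaller than all other values between `i` and `j`. -/
def DominatesBelow (f : ℕ → ℤ) (i j : ℕ) : Prop :=
  Dominates (fun m => -f m) i j

/-- The Baxter condition for the word `h 1, …, h N`. -/
def IsBaxterWord (N : ℕ) (h : ℕ → ℤ) : Prop :=
  ∀ i j k, 1 ≤ i → i < j → j + 1 < k → k ≤ N →
    ¬ (h (j + 1) < h i ∧ h i < h k ∧ h k < h j) ∧
    ¬ (h i < h (j + 1) ∧ h k < h i ∧ h j < h k)

theorem dominates_shift {f f' : ℕ → ℤ} {i j : ℕ} (s : ℕ) (K : ℤ)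
    (hf : ∀ m, (i ≤ m ∧ m ≤ j ∨ j ≤ m ∧ m ≤ i) → f' m = f (m + s) + K) :
    Dominates f (i + s) (j + s) ↔ Dominates f' i j := by
  constructor
  · intro h m hm hmi
    have := h (m + s) (by omega) (by omega)
    rw [hf m hm, hf i (by omega)]; omega
  · intro h m hm hmi
    obtain ⟨m, rfl⟩ : ∃ m', m = m' + s := ⟨m - s, by omega⟩
    have := h m (by omega) (by omega)
    rw [hf m (by omega), hf i (by omega)] at this; omega

/-- A peak between `i` and `j` exceeds its neighbour on the side of `i`, which is `i` itself or
already above the value at `i`; so a peak never obstructs domination from below. -/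
theorem dominatesBelow_delete_peak {g g' : ℕ → ℤ} {k N : ℕ}
    (hL : ∀ i, i < k → g' i = g i) (hR : ∀ i, k ≤ i → g' i = g (i + 1))
    (h1 : 1 < k → g (k - 1) < g k) (h2 : k ≤ N → g (k + 1) < g k)
    {i j i' j' : ℕ} (hi1 : 1 ≤ i) (hi2 : i ≤ N + 1) (hj1 : 1 ≤ j)
    (hi : i < k ∧ i' = i ∨ k < i ∧ i' + 1 = i) (hj : j < k ∧ j' = j ∨ k < j ∧ j' + 1 = j) :
    DominatesBelow g i j ↔ DominatesBelow g' i' j' := by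
  have e : ∀ m m', (m < k ∧ m' = m ∨ k < m ∧ m' + 1 = m) → g' m' = g m := by
    rintro m m' (⟨h, rfl⟩ | ⟨h, rfl⟩)
    · exact hL _ h
    · exact hR _ (by omega)
  constructor
  · intro h m' hm' hne
    obtain ⟨m, hm⟩ : ∃ m, m < k ∧ m' = m ∨ k < m ∧ m' + 1 = m := by
      rcases Nat.lt_or_ge m' k with h | h
      · exact ⟨m', by omega⟩
      · exact ⟨m' + 1, by omega⟩
    have := h m (by omega) (by omega)
    simp only [e m m' hm, e i i' hi]
    exact this
  · intro h
    have key : ∀ m, (i ≤ m ∧ m ≤ j ∨ j ≤ m ∧ m ≤ i) → m ≠ i → m ≠ k → g i < g m := by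
      intro m hm hne hmk
      obtain ⟨m', hm'⟩ : ∃ m', m < k ∧ m' = m ∨ k < m ∧ m' + 1 = m := by
        rcases Nat.lt_or_ge m k with h | h
        · exact ⟨m, by omega⟩
        · exact ⟨m - 1, by omega⟩
      have := h m' (by omega) (by omega)
      simp only [e m m' hm', e i i' hi] at this
      omega
    intro m hm hne
    change -g m < -g i
    by_cases hmk : m = k
    · subst hmk
      rcases hi with hi | hi
      · have hp := h1 (by omega)
        by_cases hii : i = m - 1
        · rw [hii]; omega
        · have := key (m - 1) (by omega) (by omega) (by omega); omega
      · have hp := h2 (by omega)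
        by_cases hii : i = m + 1
        · rw [hii]; omega
        · have := key (m + 1) (by omega) (by omega) (by omega); omega
    · have := key m hm hne hmk; omega

/-- A pattern can use the new maximum only as its `4`. By `hside`, one neighbour of `k` exceeds
everything on the other side of `k`. Either this contradicts the pattern at once, or that neighbour
can serve as the `4` and the pattern was already present in `h'`. -/
theorem isBaxterWord_insert_max {N k : ℕ} {h h' : ℕ → ℤ} (hb : IsBaxterWord N h')
    (hk1 : 1 ≤ k) (hk2 : k ≤ N + 1)
    (hL : ∀ i, i < k → h' i = h i) (hR : ∀ i, k ≤ i → h' i = h (i + 1))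
    (hmax : ∀ i, 1 ≤ i → i ≤ N + 1 → i ≠ k → h i < h k)
    (hside : (1 < k → ∀ j, k < j → j ≤ N + 1 → h j < h (k - 1)) ∨
      (k ≤ N → ∀ j, 1 ≤ j → j < k → h j < h (k + 1))) :
    IsBaxterWord (N + 1) h := by
  intro i j l hi hij hjl hl
  by_cases hjk : j = k
  · subst hjk
    refine ⟨fun ⟨a, b, c⟩ => ?_, fun ⟨a, b, c⟩ => ?_⟩
    · rcases hside with hs | hs
      · have hs := hs (by omega)
        by_cases hi' : i = j - 1
        · have := hs l (by omega) hl
          rw [← hi'] at this; omega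
        · refine (hb i (j - 1) (l - 1) hi (by omega) (by omega) (by omega)).1 ?_
          have := hs l (by omega) hl
          rw [hL i (by omega), hL (j - 1) (by omega), hR (l - 1) (by omega),
            hR (j - 1 + 1) (by omega), show j - 1 + 1 = j by omega, show l - 1 + 1 = l by omega]
          omega
      · have := hs (by omega) i hi hij; omega
    · have := hmax l (by omega) hl (by omega); omega
  by_cases hjk : j + 1 = k
  · subst hjk
    refine ⟨fun ⟨a, b, c⟩ => ?_, fun ⟨a, b, c⟩ => ?_⟩
    · have := hmax i (by omega) (by omega) (by omega); omega
    · rcases hside with hs | hs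
      · have := hs (by omega) l (by omega) hl
        rw [Nat.add_sub_cancel] at this; omega
      · have hs := hs (by omega) i hi (by omega)
        by_cases hl' : l = j + 1 + 1
        · subst hl'; omega
        · refine (hb i j (l - 1) hi hij (by omega) (by omega)).2 ?_
          rw [hL i (by omega), hL j (by omega), hR (l - 1) (by omega), hR (j + 1) (by omega),
            show l - 1 + 1 = l by omega]
          omega
  by_cases hik : i = k
  · subst hik
    have := hmax l (by omega) hl (by omega)
    have := hmax (j + 1) (by omega) (by omega) (by omega)
    omega
  by_cases hlk : l = k
  · subst hlk
    have := hmax i (by omega) (by omega) (by omega)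
    have := hmax j (by omega) (by omega) (by omega)
    omega
  have e : ∀ m, m ≠ k → ∃ m', h' m' = h m ∧ (m < k ∧ m' = m ∨ k < m ∧ m' + 1 = m) := by
    intro m hm
    rcases Nat.lt_or_gt_of_ne hm with h | h
    · exact ⟨m, hL m h, by omega⟩
    · exact ⟨m - 1, by rw [hR _ (by omega)]; congr 1; omega, by omega⟩
  obtain ⟨i', ei, hi'⟩ := e i (by omega)
  obtain ⟨j', ej, hj'⟩ := e j (by omega)
  obtain ⟨j'', ej', hj''⟩ := e (j + 1) (by omega)
  obtain ⟨l', el, hl'⟩ := e l (by omega)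
  obtain rfl : j'' = j' + 1 := by omega
  rw [← ei, ← ej, ← ej', ← el]
  exact hb i' j' l' (by omega) (by omega) (by omega) (by omega)

/-- No domination other than that by `k` crosses the maximum, so the two sides are never compared.
This is why they may be shifted by different constants `KL` and `KR`. -/
theorem dominates_insert_max {N k : ℕ} {f f' : ℕ → ℤ} {KL KR : ℤ}
    (hk1 : 1 ≤ k) (hk2 : k ≤ N + 1)
    (hL : ∀ i, i < k → f' i = f i + KL) (hR : ∀ i, k ≤ i → f' i = f (i + 1) + KR)
    (hmax : ∀ i, 1 ≤ i → i ≤ N + 1 → i ≠ k → f i < f k)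
    {i j : ℕ} (hi1 : 1 ≤ i) (hi2 : i ≤ N + 1) (hj1 : 1 ≤ j) (hj2 : j ≤ N + 1) :
    Dominates f i j ↔ i = k ∨ (i < k ∧ j < k ∧ Dominates f' i j) ∨
      (k < i ∧ k < j ∧ Dominates f' (i - 1) (j - 1)) := by
  have hnot : (i ≤ k ∧ k ≤ j ∨ j ≤ k ∧ k ≤ i) → i ≠ k → ¬ Dominates f i j := by
    intro h1 h2 h3
    have := h3 k h1 (by omega)
    have := hmax i hi1 hi2 h2
    omega
  rcases Nat.lt_trichotomy i k with hi | rfl | hi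
  · by_cases hj : j < k
    · have := dominates_shift (f := f) (f' := f') (i := i) (j := j) 0 KL
        (fun m hm => hL m (by omega))
      simp only [Nat.add_zero] at this
      rw [this]
      constructor
      · exact fun h => .inr (.inl ⟨hi, hj, h⟩)
      · rintro (h | h | h)
        · omega
        · exact h.2.2
        · omega
    · refine iff_of_false (hnot (by omega) (by omega)) (by omega)
  · exact iff_of_true (fun m hm hne => hmax m (by omega) (by omega) hne) (.inl rfl)
  · by_cases hj : k < j
    · have := dominates_shift (f := f) (f' := f') (i := i - 1) (j := j - 1) 1 KR
        (fun m hm => hR m (by omega))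
      rw [show i - 1 + 1 = i by omega, show j - 1 + 1 = j by omega] at this
      rw [this]
      constructor
      · exact fun h => .inr (.inr ⟨hi, hj, h⟩)
      · rintro (h | h | h)
        · omega
        · omega
        · exact h.2.2
    · refine iff_of_false (hnot (by omega) (by omega)) (by omega)

/-- Delete the position `k` of the largest value of `f`, merge the rest, and insert `N + 1` at `k`.
Deletion makes `k - 1` and `k + 1` adjacent, and the words must agree on the new ascent. The
max-tree does not compare the two sides of `k`, so one side of `f` can be lifted above the other to
match `g`. In `g` the position `k` is a peak, so its minima structure survives. -/
theorem exists_baxterWord (N : ℕ) (f g : ℕ → ℤ)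
    (hf : ∀ i j, 1 ≤ i → i ≤ N → 1 ≤ j → j ≤ N → f i = f j → i = j)
    (hg : ∀ i j, 1 ≤ i → i ≤ N → 1 ≤ j → j ≤ N → g i = g j → i = j)
    (hfg : ∀ i, 1 ≤ i → i < N → (f i < f (i + 1) ↔ g i < g (i + 1))) :
    ∃ h : ℕ → ℤ, (∀ i, 1 ≤ i → i ≤ N → 1 ≤ h i ∧ h i ≤ N) ∧
      (∀ i j, 1 ≤ i → i ≤ N → 1 ≤ j → j ≤ N → h i = h j → i = j) ∧ IsBaxterWord N h ∧
      (∀ i j, 1 ≤ i → i ≤ N → 1 ≤ j → j ≤ N → (Dominates f i j ↔ Dominates h i j)) ∧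
      (∀ i j, 1 ≤ i → i ≤ N → 1 ≤ j → j ≤ N → (DominatesBelow g i j ↔ DominatesBelow h i j)) := by
  induction N generalizing f g with
  | zero => exact ⟨f, by omega, by omega, fun i j k => by omega, by omega, by omega⟩
  | succ N ih =>
    obtain ⟨k, hk, hkmax⟩ := (Finset.Icc 1 (N + 1)).exists_max_image f ⟨1, by simp⟩
    simp only [Finset.mem_Icc] at hk hkmax
    have hmax : ∀ i, 1 ≤ i → i ≤ N + 1 → i ≠ k → f i < f k := fun i h1 h2 h3 =>
      lt_of_le_of_ne (hkmax i ⟨h1, h2⟩) fun h => h3 (hf i k h1 h2 hk.1 hk.2 h)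
    obtain ⟨K, hK⟩ : ∃ K : ℤ, ∀ i j, i ≤ N + 1 → j ≤ N + 1 → f i < f j + K := by
      obtain ⟨M, hM⟩ := ((Set.finite_Iic (N + 1)).image f).bddAbove
      obtain ⟨M', hM'⟩ := ((Set.finite_Iic (N + 1)).image f).bddBelow
      refine ⟨M - M' + 1, fun i j hi hj => ?_⟩
      have := hM ⟨i, hi, rfl⟩
      have := hM' ⟨j, hj, rfl⟩
      omega
    have hgne : ∀ i j, 1 ≤ i → i ≤ N + 1 → 1 ≤ j → j ≤ N + 1 → i ≠ j → g i ≠ g j :=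
      fun i j h1 h2 h3 h4 h5 h6 => h5 (hg i j h1 h2 h3 h4 h6)
    have peak : ∀ w : ℕ → ℤ, (∀ i, 1 ≤ i → i < N + 1 → (f i < f (i + 1) ↔ w i < w (i + 1))) →
        (∀ i, 1 ≤ i → i < N + 1 → w i ≠ w (i + 1)) →
        (1 < k → w (k - 1) < w k) ∧ (k ≤ N → w (k + 1) < w k) := by
      intro w hw hne
      constructor
      · intro h
        have h1 := hw (k - 1) (by omega) (by omega)
        have h2 := hmax (k - 1) (by omega) (by omega) (by omega)
        rw [show k - 1 + 1 = k by omega] at h1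
        exact h1.1 h2
      · intro h
        have h1 := hw k (by omega) (by omega)
        have h2 := hmax (k + 1) (by omega) (by omega) (by omega)
        have h3 := hne k (by omega) (by omega)
        omega
    have gpeak := peak g hfg fun i h1 h2 => hgne i (i + 1) h1 (by omega) (by omega) (by omega)
      (by omega)
    -- The side of the larger `g`-neighbour of `k` is lifted. If `k` is an end of the word, one side
    -- is empty and the choice is immaterial.
    obtain ⟨KL, KR, hKK⟩ : ∃ KL KR : ℤ, (KL = K ∧ KR = 0 ∧ g (k + 1) < g (k - 1)) ∨
        (KL = 0 ∧ KR = K ∧ g (k - 1) ≤ g (k + 1)) := by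
      rcases lt_or_ge (g (k + 1)) (g (k - 1)) with h | h
      · exact ⟨K, 0, .inl ⟨rfl, rfl, h⟩⟩
      · exact ⟨0, K, .inr ⟨rfl, rfl, h⟩⟩
    set f' : ℕ → ℤ := fun i => if i < k then f i + KL else f (i + 1) + KR with hf'
    set g' : ℕ → ℤ := fun i => if i < k then g i else g (i + 1) with hg'
    have fL : ∀ i, i < k → f' i = f i + KL := fun i h => if_pos h
    have fR : ∀ i, k ≤ i → f' i = f (i + 1) + KR := fun i h => if_neg (by omega)
    have gL : ∀ i, i < k → g' i = g i := fun i h => if_pos h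
    have gR : ∀ i, k ≤ i → g' i = g (i + 1) := fun i h => if_neg (by omega)
    have cross : ∀ i j, i < k → k ≤ j → j ≤ N →
        (g (k + 1) < g (k - 1) → f' j < f' i) ∧ (g (k - 1) ≤ g (k + 1) → f' i < f' j) := by
      intro i j h1 h2 h3
      rw [fL i h1, fR j h2]
      have := hK i (j + 1) (by omega) (by omega)
      have := hK (j + 1) i (by omega) (by omega)
      omega
    obtain ⟨h', hr, hinj, hbax, hdom, hbel⟩ := ih f' g' (by
      intro i j h1 h2 h3 h4 h5
      rcases Nat.lt_or_ge i k with hi | hi <;> rcases Nat.lt_or_ge j k with hj | hj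
      · rw [fL i hi, fL j hj] at h5
        exact hf i j h1 (by omega) h3 (by omega) (by omega)
      · have := cross i j hi hj h4; omega
      · have := cross j i hj hi h2; omega
      · rw [fR i hi, fR j hj] at h5
        have := hf (i + 1) (j + 1) (by omega) (by omega) (by omega) (by omega) (by omega)
        omega) (by
      intro i j h1 h2 h3 h4 h5
      rcases Nat.lt_or_ge i k with hi | hi <;> rcases Nat.lt_or_ge j k with hj | hj
      · rw [gL i hi, gL j hj] at h5
        exact hg i j h1 (by omega) h3 (by omega) h5
      · rw [gL i hi, gR j hj] at h5
        have := hg i (j + 1) h1 (by omega) (by omega) (by omega) h5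
        omega
      · rw [gR i hi, gL j hj] at h5
        have := hg (i + 1) j (by omega) (by omega) (by omega) (by omega) h5
        omega
      · rw [gR i hi, gR j hj] at h5
        have := hg (i + 1) (j + 1) (by omega) (by omega) (by omega) (by omega) h5
        omega) (by
      intro i h1 h2
      rcases Nat.lt_trichotomy (i + 1) k with hi | hi | hi
      · rw [fL i (by omega), fL (i + 1) hi, gL i (by omega), gL (i + 1) hi, add_lt_add_iff_right]
        exact hfg i h1 (by omega)
      · have := cross i (i + 1) (by omega) (by omega) (by omega)
        rw [gL i (by omega), gR (i + 1) (by omega)]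
        have hne := hgne (k - 1) (k + 1) (by omega) (by omega) (by omega) (by omega) (by omega)
        rw [hi]
        obtain rfl : i = k - 1 := by omega
        rw [show k - 1 + 1 = k by omega] at this
        omega
      · rw [fR i (by omega), fR (i + 1) (by omega), gR i (by omega), gR (i + 1) (by omega),
          add_lt_add_iff_right]
        exact hfg (i + 1) (by omega) (by omega))
    set h : ℕ → ℤ := fun i => if i < k then h' i else if i = k then N + 1 else h' (i - 1) with hh
    have hL : ∀ i, i < k → h' i = h i := fun i hi => (if_pos hi).symm
    have hR : ∀ i, k ≤ i → h' i = h (i + 1) := fun i hi => by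
      simp only [hh]; rw [if_neg (by omega), if_neg (by omega)]; rfl
    have hk0 : h k = N + 1 := by simp [hh]
    have e : ∀ m, m ≠ k → ∃ m', h' m' = h m ∧ (m < k ∧ m' = m ∨ k < m ∧ m' + 1 = m) := by
      intro m hm
      rcases Nat.lt_or_gt_of_ne hm with h | h
      · exact ⟨m, hL m h, by omega⟩
      · exact ⟨m - 1, by rw [hR _ (by omega)]; congr 1; omega, by omega⟩
    have hhmax : ∀ i, 1 ≤ i → i ≤ N + 1 → i ≠ k → 1 ≤ h i ∧ h i < h k := by
      intro i h1 h2 h3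
      obtain ⟨m, hm, hm'⟩ := e i h3
      have := hr m (by omega) (by omega)
      omega
    have hhinj : ∀ i j, 1 ≤ i → i ≤ N + 1 → 1 ≤ j → j ≤ N + 1 → h i = h j → i = j := by
      intro i j h1 h2 h3 h4 h5
      by_cases hi : i = k
      · by_contra hne
        have := hhmax j h3 h4 (by omega)
        rw [hi] at h5; omega
      by_cases hj : j = k
      · have := hhmax i h1 h2 (by omega)
        rw [hj] at h5; omega
      obtain ⟨i', ei, hi'⟩ := e i hi
      obtain ⟨j', ej, hj'⟩ := e j hj
      have := hinj i' j' (by omega) (by omega) (by omega) (by omega) (by rw [ei, ej, h5])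
      omega
    have hdomh : ∀ i j, 1 ≤ i → i ≤ N + 1 → 1 ≤ j → j ≤ N + 1 →
        (Dominates f i j ↔ Dominates h i j) := by
      intro i j h1 h2 h3 h4
      rw [dominates_insert_max hk.1 hk.2 fL fR hmax h1 h2 h3 h4,
        dominates_insert_max (f' := h') (KL := 0) (KR := 0) hk.1 hk.2 (fun i hi => by rw [hL i hi, add_zero])
          (fun i hi => by rw [hR i hi, add_zero]) (fun i h1 h2 h3 => (hhmax i h1 h2 h3).2)
          h1 h2 h3 h4]
      refine or_congr Iff.rfl (or_congr ?_ ?_)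
      · refine and_congr_right fun hi => and_congr_right fun hj => ?_
        exact hdom i j h1 (by omega) h3 (by omega)
      · refine and_congr_right fun hi => and_congr_right fun hj => ?_
        exact hdom (i - 1) (j - 1) (by omega) (by omega) (by omega) (by omega)
    have hasc : ∀ i, 1 ≤ i → i < N + 1 → (f i < f (i + 1) ↔ h i < h (i + 1)) := by
      intro i h1 h2
      have := hdomh (i + 1) i (by omega) (by omega) h1 (by omega)
      have e : ∀ w : ℕ → ℤ, Dominates w (i + 1) i ↔ w i < w (i + 1) := by
        intro w
        refine ⟨fun h => h i (by omega) (by omega), fun h m hm hne => ?_⟩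
        obtain rfl : m = i := by omega
        exact h
      rwa [e, e] at this
    have hpeak := peak h hasc fun i h1 h2 h3 => by
      have := hhinj i (i + 1) h1 (by omega) (by omega) (by omega) h3; omega
    refine ⟨h, ?_, hhinj, ?_, hdomh, ?_⟩
    · intro i h1 h2
      by_cases hi : i = k
      · rw [hi, hk0]; push_cast; omega
      · have := hhmax i h1 h2 hi
        rw [hk0] at this; push_cast; omega
    · refine isBaxterWord_insert_max hbax hk.1 hk.2 hL hR
        (fun i h1 h2 h3 => (hhmax i h1 h2 h3).2) ?_
      rcases lt_or_ge (g (k + 1)) (g (k - 1)) with hc | hc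
      · left
        intro h1 j h2 h3
        have := (hdom (k - 1) (j - 1) (by omega) (by omega) (by omega) (by omega)).1 (by
          intro m hm hne
          exact (cross (k - 1) m (by omega) (by omega) (by omega)).1 hc) (j - 1) (by omega)
            (by omega)
        rw [hL (k - 1) (by omega), hR (j - 1) (by omega), show j - 1 + 1 = j by omega] at this
        exact this
      · right
        intro h1 j h2 h3
        have := (hdom k j (by omega) (by omega) (by omega) (by omega)).1 (by
          intro m hm hne
          exact (cross m k (by omega) (by omega) (by omega)).2 hc) j (by omega)
            (by omega)
        rw [hL j (by omega), hR k (by omega)] at this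
        exact this
    · intro i j h1 h2 h3 h4
      by_cases hi : i = k
      -- From below, a peak dominates nothing but itself.
      · have aux : ∀ w : ℕ → ℤ, ((1 < k → w (k - 1) < w k) ∧ (k ≤ N → w (k + 1) < w k)) →
            (DominatesBelow w i j ↔ j = k) := by
          intro w hw
          constructor
          · intro hd
            by_contra hne
            rcases Nat.lt_or_gt_of_ne hne with hlt | hgt
            · have h5 : -w (k - 1) < -w i := hd (k - 1) (by omega) (by omega)
              have := hw.1 (by omega)
              rw [hi] at h5; omega
            · have h5 : -w (k + 1) < -w i := hd (k + 1) (by omega) (by omega)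
              have := hw.2 (by omega)
              rw [hi] at h5; omega
          · rintro rfl m hm hne; omega
        rw [aux g gpeak, aux h hpeak]
      by_cases hj : j = k
      -- Dominating as far as a peak amounts to dominating as far as its neighbour on the side of
      -- `i`.
      · have aux : ∀ w : ℕ → ℤ, ((1 < k → w (k - 1) < w k) ∧ (k ≤ N → w (k + 1) < w k)) →
            (DominatesBelow w i k ↔ DominatesBelow w i (if i < k then k - 1 else k + 1)) := by
          intro w hw
          constructor
          · intro hd m hm hne
            exact hd m (by split_ifs at hm <;> omega) hne
          · intro hd m hm hne
            by_cases hmk : m = k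
            · subst hmk
              change - w m < - w i
              by_cases hlt : i < m
              · have := hw.1 (by omega)
                rw [if_pos hlt] at hd
                by_cases hii : i = m - 1
                · rw [hii]; omega
                · have : -w (m - 1) < -w i := hd (m - 1) (by omega) (by omega); omega
              · have := hw.2 (by omega)
                rw [if_neg hlt] at hd
                by_cases hii : i = m + 1
                · rw [hii]; omega
                · have : -w (m + 1) < -w i := hd (m + 1) (by omega) (by omega); omega
            · exact hd m (by split_ifs <;> omega) hne
        rw [hj, aux g gpeak, aux h hpeak]
        by_cases hlt : i < k
        · rw [if_pos hlt, dominatesBelow_delete_peak gL gR gpeak.1 gpeak.2 (i' := i) (j' := k - 1)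
            h1 h2 (by omega) (by omega) (by omega),
            dominatesBelow_delete_peak hL hR hpeak.1 hpeak.2 (i' := i) (j' := k - 1)
            h1 h2 (by omega) (by omega) (by omega)]
          exact hbel i (k - 1) (by omega) (by omega) (by omega) (by omega)
        · rw [if_neg hlt, dominatesBelow_delete_peak gL gR gpeak.1 gpeak.2 (i' := i - 1) (j' := k)
            h1 h2 (by omega) (by omega) (by omega),
            dominatesBelow_delete_peak hL hR hpeak.1 hpeak.2 (i' := i - 1) (j' := k)
            h1 h2 (by omega) (by omega) (by omega)]
          exact hbel (i - 1) k (by omega) (by omega) (by omega) (by omega)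
      obtain ⟨i', ei, hi'⟩ := e i hi
      obtain ⟨j', ej, hj'⟩ := e j hj
      rw [dominatesBelow_delete_peak gL gR gpeak.1 gpeak.2 h1 h2 h3 hi' hj',
        dominatesBelow_delete_peak hL hR hpeak.1 hpeak.2 h1 h2 h3 hi' hj']
      exact hbel i' j' (by omega) (by omega) (by omega) (by omega)

/-! ### Permutations as bordered words; twin pairs -/

/-- The value of `π` at the position `i`, counted from `1`, and `M` outside `[1, m]`. -/
def valueAt {m : ℕ} (π : Equiv.Perm (Fin m)) (M : ℤ) (i : ℕ) : ℤ :=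
  if h : 1 ≤ i ∧ i ≤ m then ((π ⟨i - 1, by omega⟩ : ℕ) : ℤ) + 1 else M

/-- `f` and `-g` describe the same permutation of `[N]`, where `f` and `g` are continued by values
that are larger than those in `[1, N]`. -/
structure IsBorderedWord (N : ℕ) (f g : ℕ → ℤ) : Prop where
  eq : ∀ i, 1 ≤ i → i ≤ N → g i = -f i
  one_le : ∀ i, 1 ≤ i → i ≤ N → 1 ≤ f i
  le : ∀ i, 1 ≤ i → i ≤ N → f i ≤ N
  inj : ∀ i j, 1 ≤ i → i ≤ N → 1 ≤ j → j ≤ N → f i = f j → i = j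
  upper_zero : f 0 = N + 1
  upper_last : f (N + 1) = N + 1
  neg_zero : g 0 = 0
  neg_last : g (N + 1) = 0

theorem valueAt_succ {m : ℕ} (π : Equiv.Perm (Fin m)) (M : ℤ) (i : Fin m) :
    valueAt π M (i + 1) = (π i : ℕ) + 1 := by
  rw [valueAt, dif_pos (by omega)]
  congr

theorem exists_fin {m i : ℕ} (h1 : 1 ≤ i) (h2 : i ≤ m) : ∃ j : Fin m, i = j + 1 :=
  ⟨⟨i - 1, by omega⟩, by simp; omega⟩

theorem isBorderedWord_valueAt {m : ℕ} (π : Equiv.Perm (Fin m)) :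
    IsBorderedWord m (valueAt π (m + 1)) (fun i => -valueAt π 0 i) where
  eq i h1 h2 := by
    obtain ⟨j, rfl⟩ := exists_fin h1 h2
    rw [valueAt_succ, valueAt_succ]
  one_le i h1 h2 := by
    obtain ⟨j, rfl⟩ := exists_fin h1 h2
    rw [valueAt_succ]; omega
  le i h1 h2 := by
    obtain ⟨j, rfl⟩ := exists_fin h1 h2
    rw [valueAt_succ]; have := (π j).2; omega
  inj i j h1 h2 h3 h4 h := by
    obtain ⟨i, rfl⟩ := exists_fin h1 h2
    obtain ⟨j, rfl⟩ := exists_fin h3 h4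
    rw [valueAt_succ, valueAt_succ] at h
    have : i = j := π.injective (Fin.ext (by omega))
    rw [this]
  upper_zero := dif_neg (by omega)
  upper_last := dif_neg (by omega)
  neg_zero := by simp [valueAt]
  neg_last := by simp [valueAt]

theorem nodup_oneLine {m : ℕ} (π : Equiv.Perm (Fin m)) : (oneLine π).Nodup := by
  rw [oneLine, List.nodup_ofFn]
  intro i j h
  exact π.injective (Fin.ext (by simpa using h))

theorem length_oneLine {m : ℕ} (π : Equiv.Perm (Fin m)) : (oneLine π).length = m := by
  simp [oneLine]

theorem isMaxTree_treePair_fst {m : ℕ} (π : Equiv.Perm (Fin m)) :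
    IsMaxTree (valueAt π (m + 1)) 0 m (treePair π).1 := by
  have := isMaxTree_maxTree (oneLine π) (nodup_oneLine π) (valueAt π (m + 1)) 0 (fun i hi => by
    rw [length_oneLine] at hi
    have := valueAt_succ π (m + 1) ⟨i, hi⟩
    simp only [zero_add, this, oneLine, List.getElem_ofFn]
    push_cast; rfl)
  rwa [length_oneLine, zero_add] at this

theorem isMaxTree_treePair_snd {m : ℕ} (π : Equiv.Perm (Fin m)) :
    IsMaxTree (fun i => -valueAt π 0 (m + 1 - i)) 0 m (treePair π).2 := by
  have := isMaxTree_minTree (oneLine π).reverse (List.nodup_reverse.2 (nodup_oneLine π))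
    (fun i => -valueAt π 0 (m + 1 - i)) 0 (fun i hi => by
    rw [List.length_reverse, length_oneLine] at hi
    have := valueAt_succ π 0 ⟨m - 1 - i, by omega⟩
    simp only [oneLine, List.getElem_reverse, List.getElem_ofFn, List.length_ofFn]
    rw [show m + 1 - (0 + i + 1) = m - 1 - i + 1 by omega, this]
    push_cast; rfl)
  rwa [List.length_reverse, length_oneLine, zero_add] at this

theorem isBaxter_iff {m : ℕ} (π : Equiv.Perm (Fin m)) (M : ℤ) :
    IsBaxter π ↔ IsBaxterWord m (valueAt π M) := by
  constructor
  · intro h i j k h1 h2 h3 h4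
    obtain ⟨i, rfl⟩ := exists_fin (m := m) h1 (by omega)
    obtain ⟨j', hj'⟩ := exists_fin (m := m) (i := j + 1) (by omega) (by omega)
    obtain ⟨j, rfl⟩ := exists_fin (m := m) (i := j) (by omega) (by omega)
    obtain ⟨k, rfl⟩ := exists_fin (m := m) (i := k) (by omega) h4
    rw [hj']
    simp only [valueAt_succ]
    constructor
    · rintro ⟨a, b, c⟩
      exact h ⟨i, j, j', k, by omega, by omega, by omega,
        .inl ⟨Fin.lt_def.2 (by omega), Fin.lt_def.2 (by omega), Fin.lt_def.2 (by omega)⟩⟩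
    · rintro ⟨a, b, c⟩
      exact h ⟨i, j, j', k, by omega, by omega, by omega,
        .inr ⟨Fin.lt_def.2 (by omega), Fin.lt_def.2 (by omega), Fin.lt_def.2 (by omega)⟩⟩
  · rintro h ⟨i, j, j', k, h1, h2, h3, h4⟩
    have hb := h (i + 1) (j + 1) (k + 1) (by omega) (by omega) (by omega) (by omega)
    rw [show (j : ℕ) + 1 + 1 = j' + 1 by omega] at hb
    simp only [valueAt_succ] at hb
    rcases h4 with ⟨a, b, c⟩ | ⟨a, b, c⟩
    · simp only [Fin.lt_def] at a b c
      exact hb.1 (by omega)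
    · simp only [Fin.lt_def, gt_iff_lt] at a b c
      exact hb.2 (by omega)

/-- Reversing a word exchanges ascents and descents, negating it exchanges them back, and reversing
the fingerprint restores the positions. -/
theorem mem_twinPairs_iff {N : ℕ} {f g : ℕ → ℤ} {S T : BinaryTree Unit}
    (hS : IsMaxTree f 0 N S) (hT : IsMaxTree (fun i => -g (N + 1 - i)) 0 N T) :
    (S, T) ∈ twinPairs (N + 1) ↔
      ∀ i, 1 ≤ i → i < N → (f (i + 1) < f i ↔ g (i + 1) < g i) := by
  have e1 := hS.eq_add_numNodes
  have e2 := hT.eq_add_numNodes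
  simp only [twinPairs, Set.mem_ofPred_eq, BinaryTree.numLeaves_eq_numNodes_succ,
    reducedFingerprint_eq_map hS, reducedFingerprint_eq_map hT]
  rw [zero_add] at e1 e2
  rw [← e1, ← e2, List.ext_getElem_iff]
  simp only [List.length_map, List.length_range', List.length_reverse, List.getElem_map,
    List.getElem_range', List.getElem_reverse, true_and, neg_lt_neg_iff, decide_eq_decide]
  constructor
  · intro h i h1 h2
    have := h (i - 1) (by omega) (by omega)
    rw [show 1 + 1 * (i - 1) = i by omega,
      show N + 1 - (1 + 1 * (N - 1 - 1 - (i - 1))) = i + 1 by omega,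
      show N + 1 - (1 + 1 * (N - 1 - 1 - (i - 1)) + 1) = i by omega] at this
    exact this
  · intro h i h1 h2
    have := h (i + 1) (by omega) (by omega)
    rw [show 1 + 1 * i = i + 1 by omega,
      show N + 1 - (1 + 1 * (N - 1 - 1 - i)) = i + 1 + 1 by omega,
      show N + 1 - (1 + 1 * (N - 1 - 1 - i) + 1) = i + 1 by omega]
    exact this

theorem treePair_mem_twinPairs {m : ℕ} (π : Equiv.Perm (Fin m)) :
    treePair π ∈ twinPairs (m + 1) := by
  refine (mem_twinPairs_iff (isMaxTree_treePair_fst π) (isMaxTree_treePair_snd π)).2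
    fun i h1 h2 => ?_
  have h := isBorderedWord_valueAt π
  have h3 := h.eq i h1 (by omega)
  have h4 := h.eq (i + 1) (by omega) (by omega)
  omega

theorem dominates_mirror (g : ℕ → ℤ) {N i j : ℕ} (hi : 1 ≤ i) (hi' : i ≤ N) (hj : 1 ≤ j)
    (hj' : j ≤ N) :
    Dominates (fun i => -g (N + 1 - i)) i j ↔ DominatesBelow g (N + 1 - i) (N + 1 - j) := by
  constructor
  · intro h m hm hne
    have := h (N + 1 - m) (by omega) (by omega)
    simp only at this
    rwa [show N + 1 - (N + 1 - m) = m by omega] at this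
  · intro h m hm hne
    exact h (N + 1 - m) (by omega) (by omega)

theorem exists_isBaxter_treePair_eq {m : ℕ} {S T : BinaryTree Unit}
    (h : (S, T) ∈ twinPairs (m + 1)) :
    ∃ π : Equiv.Perm (Fin m), IsBaxter π ∧ treePair π = (S, T) := by
  obtain ⟨f, -, finj, hf⟩ := exists_isMaxTree S 0
  obtain ⟨g', -, ginj, hg⟩ := exists_isMaxTree T 0
  have hS : S.numNodes = m := by
    have := h.1; rw [BinaryTree.numLeaves_eq_numNodes_succ] at this; simpa using this
  have hT : T.numNodes = m := by
    have := h.2.1; rw [BinaryTree.numLeaves_eq_numNodes_succ] at this; simpa using this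
  rw [zero_add, hS] at hf finj
  rw [zero_add, hT] at hg ginj
  -- `T` is to be the max-tree of a reversed and negated word; `g` undoes both operations.
  set g : ℕ → ℤ := fun i => -g' (m + 1 - i)
  have hg' : IsMaxTree (fun i => -g (m + 1 - i)) 0 m T := hg.congr fun i j h1 h2 h3 h4 => by
    refine forall₃_congr fun k hk hki => ?_
    simp only [g, neg_neg]
    rw [show m + 1 - (m + 1 - k) = k by omega, show m + 1 - (m + 1 - i) = i by omega]
  have hfg := (mem_twinPairs_iff hf hg').1 h
  have ginj' : ∀ i j, 1 ≤ i → i ≤ m → 1 ≤ j → j ≤ m → g i = g j → i = j := by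
    intro i j h1 h2 h3 h4 h5
    have := ginj (m + 1 - i) (m + 1 - j) (by omega) (by omega) (by omega) (by omega)
      (neg_injective h5)
    omega
  obtain ⟨w, hr, winj, hb, hd1, hd2⟩ := exists_baxterWord m f g
    (fun i j h1 h2 h3 h4 => finj i j h1 h2 h3 h4) ginj' (fun i h1 h2 => by
      have := hfg i h1 h2
      have a : f i ≠ f (i + 1) := fun h => by
        have := finj i (i + 1) (by omega) (by omega) (by omega) (by omega) h; omega
      have b : g i ≠ g (i + 1) := fun h => by
        have := ginj' i (i + 1) (by omega) (by omega) (by omega) (by omega) h; omega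
      omega)
  have hw : ∀ i : Fin m, (w (i + 1) - 1).toNat < m := fun i => by
    have := hr (i + 1) (by omega) (by omega); omega
  have hinj : Function.Injective fun i : Fin m => (⟨(w (i + 1) - 1).toNat, hw i⟩ : Fin m) := by
    intro i j hij
    rw [Fin.mk.injEq] at hij
    have h1 := hr (i + 1) (by omega) (by omega)
    have h2 := hr (j + 1) (by omega) (by omega)
    have := winj (i + 1) (j + 1) (by omega) (by omega) (by omega) (by omega) (by omega)
    exact Fin.ext (by omega)
  set π : Equiv.Perm (Fin m) := Equiv.ofBijective _ (Finite.injective_iff_bijective.1 hinj)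
  have hπ : ∀ M i, 1 ≤ i → i ≤ m → valueAt π M i = w i := by
    intro M i h1 h2
    obtain ⟨i, rfl⟩ := exists_fin h1 h2
    have := hr (i + 1) (by omega) (by omega)
    rw [valueAt_succ]
    change (((w (i + 1) - 1).toNat : ℕ) : ℤ) + 1 = _
    omega
  refine ⟨π, (isBaxter_iff π 0).2 fun i j k h1 h2 h3 h4 => ?_, Prod.ext ?_ ?_⟩
  · rw [hπ 0 i (by omega) (by omega), hπ 0 j (by omega) (by omega),
      hπ 0 k (by omega) (by omega), hπ 0 (j + 1) (by omega) (by omega)]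
    exact hb i j k h1 h2 h3 h4
  · refine (isMaxTree_treePair_fst π).unique (hf.congr fun i j h1 h2 h3 h4 => ?_)
    rw [hd1 i j h1 h2 h3 h4]
    refine forall₃_congr fun k hk hki => ?_
    rw [hπ _ i (by omega) (by omega), hπ _ k (by omega) (by omega)]
  · refine (isMaxTree_treePair_snd π).unique (hg'.congr fun i j h1 h2 h3 h4 => ?_)
    rw [dominates_mirror g h1 h2 h3 h4, dominates_mirror _ h1 h2 h3 h4,
      hd2 _ _ (by omega) (by omega) (by omega) (by omega)]
    refine forall₃_congr fun k hk hki => ?_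
    simp only
    rw [hπ 0 (m + 1 - i) (by omega) (by omega), hπ 0 k (by omega) (by omega)]

/-! ### The intervals of a position in its two trees -/

/-- The last position before `k` with a value larger than the one at `k`; this is the leftmost leaf
below the vertex `k` of the max-tree. -/
def leftLeaf (f : ℕ → ℤ) (k : ℕ) : ℕ :=
  Nat.findGreatest (fun c => f k < f c) (k - 1)

/-- The predecessor of the first position after `k` with a value larger than the one at `k`; this
is the rightmost leaf below the vertex `k` of the max-tree. -/
noncomputable def rightLeaf (f : ℕ → ℤ) (k : ℕ) : ℕ :=
  sInf {d | k ≤ d ∧ f k < f (d + 1)}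

theorem isVertex_leftLeaf_rightLeaf {f : ℕ → ℤ} {N k : ℕ} (h1 : 1 ≤ k) (h2 : k ≤ N)
    (h0 : f k < f 0) (hN : f k < f (N + 1))
    (hne : ∀ m, 1 ≤ m → m ≤ N → m ≠ k → f m ≠ f k) :
    IsVertex f (leftLeaf f k) k (rightLeaf f k) ∧ rightLeaf f k ≤ N := by
  have hl := Nat.findGreatest_le (P := fun c => f k < f c) (k - 1)
  have hmem : N ∈ {d | k ≤ d ∧ f k < f (d + 1)} := ⟨h2, hN⟩
  have hr := Nat.sInf_mem ⟨N, hmem⟩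
  have hrN : rightLeaf f k ≤ N := Nat.sInf_le hmem
  refine ⟨⟨?_, hr.1, fun m hm1 hm2 hm3 => ?_, ?_, hr.2⟩, hrN⟩
  · rw [leftLeaf]; omega
  · refine lt_of_le_of_ne (not_lt.1 fun hlt => ?_) (hne m (by omega) (by omega) hm3)
    rcases Nat.lt_or_gt_of_ne hm3 with hmk | hmk
    · exact absurd (Nat.le_findGreatest (P := fun c => f k < f c) (n := k - 1) (by omega) hlt)
        (by rw [leftLeaf] at hm1; omega)
    · obtain ⟨m, rfl⟩ : ∃ m', m = m' + 1 := ⟨m - 1, by omega⟩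
      exact absurd (Nat.sInf_le (s := {d | k ≤ d ∧ f k < f (d + 1)}) ⟨by omega, hlt⟩)
        (by rw [rightLeaf] at hm2; omega)
  · exact Nat.findGreatest_spec (P := fun c => f k < f c) (Nat.zero_le _) h0

namespace IsBorderedWord

variable {N : ℕ} {f g : ℕ → ℤ}

theorem isVertex_left (h : IsBorderedWord N f g) {k : ℕ} (h1 : 1 ≤ k) (h2 : k ≤ N) :
    IsVertex f (leftLeaf f k) k (rightLeaf f k) ∧ rightLeaf f k ≤ N := by
  have := h.le k h1 h2
  refine isVertex_leftLeaf_rightLeaf h1 h2 ?_ ?_ fun m h3 h4 h5 h6 => h5 (h.inj m k h3 h4 h1 h2 h6)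
  · rw [h.upper_zero]; omega
  · rw [h.upper_last]; omega

theorem isVertex_right (h : IsBorderedWord N f g) {k : ℕ} (h1 : 1 ≤ k) (h2 : k ≤ N) :
    IsVertex g (leftLeaf g k) k (rightLeaf g k) ∧ rightLeaf g k ≤ N := by
  have := h.one_le k h1 h2
  have e := h.eq k h1 h2
  refine isVertex_leftLeaf_rightLeaf h1 h2 ?_ ?_ fun m h3 h4 h5 h6 => h5 (h.inj m k h3 h4 h1 h2 ?_)
  · rw [h.neg_zero]; omega
  · rw [h.neg_last]; omega
  · have := h.eq m h3 h4; omega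

/-- Values on `(c, d]` are at most `f k` and values on `(p, e]` at least `f k`, so the two intervals
around `k` share only `k`. Consequently, on each side of `k` at least one of them stops immediately;
the geometry of the cells rests on this. -/
theorem eq_of_common (h : IsBorderedWord N f g) {c k d p e : ℕ} (hf : IsVertex f c k d)
    (hg : IsVertex g p k e) (hd : d ≤ N) {m : ℕ} (h1 : c < m) (h2 : p < m) (h3 : m ≤ d)
    (h4 : m ≤ e) : m = k := by
  by_contra hne
  have := hf.max m h1 h3 hne
  have := hg.max m h2 h4 hne
  have := h.eq m (by omega) (by omega)
  have := h.eq k (by have := hf.lt; omega) (by have := hf.le; omega)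
  omega

end IsBorderedWord

/-! ### The glued drawing -/

/-- The four kinds of segments in the glued drawing. -/
def OnSegment (N : ℕ) (f g : ℕ → ℤ) (p : ℝ × ℝ) (c d : ℕ) : Prop :=
  ((∀ m, c < m → m ≤ d → f m < f c) ∧ p.2 = N - c ∧ (c : ℝ) ≤ p.1 ∧ p.1 ≤ d) ∨
  ((∀ m, c < m → m ≤ d → f m < f (d + 1)) ∧ p.1 = d ∧ (N : ℝ) - d ≤ p.2 ∧ p.2 ≤ N - c) ∨
  ((∀ m, c < m → m ≤ d → g m < g (d + 1)) ∧ p.2 = N - d ∧ (c : ℝ) ≤ p.1 ∧ p.1 ≤ d) ∨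
  ((∀ m, c < m → m ≤ d → g m < g c) ∧ p.1 = c ∧ (N : ℝ) - d ≤ p.2 ∧ p.2 ≤ N - c)

/-- A bordered word together with its two trees. -/
structure IsTreePair (N : ℕ) (f g : ℕ → ℤ) (S T : BinaryTree Unit) : Prop extends
    IsBorderedWord N f g where
  left : IsMaxTree f 0 N S
  right : IsMaxTree (fun i => g (N + 1 - i)) 0 N T

namespace IsTreePair

variable {N : ℕ} {f g : ℕ → ℤ} {S T : BinaryTree Unit}

theorem side_eq (h : IsTreePair N f g S T) : side S = N := by
  have := h.left.eq_add_numNodes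
  rw [side, this, zero_add]

theorem border_left (h : IsTreePair N f g S T) : ∀ m, 0 < m → m ≤ N → f m < f 0 ∧ f m < f (N + 1) :=
  fun m h1 h2 => by
    have := h.le m h1 h2
    rw [h.upper_zero, h.upper_last]; omega

theorem border_right (h : IsTreePair N f g S T) : ∀ m, 0 < m → m ≤ N →
    g (N + 1 - m) < g (N + 1 - 0) ∧ g (N + 1 - m) < g (N + 1 - (N + 1)) := fun m h1 h2 => by
  have := h.one_le (N + 1 - m) (by omega) (by omega)
  rw [Nat.sub_self, Nat.sub_zero, h.neg_zero, h.neg_last, h.eq _ (by omega) (by omega)]; omega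

/-- The half-turn cancels the reversal built into `T`: its leaves `c, …, d` land on the leaves `N -
d, …, N - c` of `S`, so both trees are described by positions of the same word. -/
theorem mem_gluedDrawing_iff (h : IsTreePair N f g S T) (p : ℝ × ℝ) :
    p ∈ gluedDrawing S T ↔ ∃ c d : ℕ, c < d ∧ d ≤ N ∧ OnSegment N f g p c d := by
  have hturn : p ∈ halfTurn (N : ℝ) '' drawing N 0 T ↔ halfTurn N p ∈ drawing N 0 T := by
    constructor
    · rintro ⟨q, hq, rfl⟩; simpa [halfTurn] using hq
    · intro hp; exact ⟨_, hp, by simp [halfTurn]⟩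
  rw [gluedDrawing, h.side_eq, Set.mem_union, hturn, mem_drawing_iff h.left h.border_left,
    mem_drawing_iff h.right h.border_right]
  simp only [halfTurn]
  constructor
  · rintro (⟨c, d, -, h2, h3, h4⟩ | ⟨c, d, -, h2, h3, h4⟩)
    · refine ⟨c, d, h2, h3, ?_⟩
      rcases h4 with h4 | h4
      · exact .inl h4
      · exact .inr (.inl h4)
    · have e1 : ((N - c : ℕ) : ℝ) = N - c := by push_cast [show c ≤ N by omega]; rfl
      have e2 : ((N - d : ℕ) : ℝ) = N - d := by push_cast [show d ≤ N by omega]; rfl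
      refine ⟨N - d, N - c, by omega, by omega, ?_⟩
      rcases h4 with ⟨h4, h5, h6, h7⟩ | ⟨h4, h5, h6, h7⟩
      · refine .inr (.inr (.inl ⟨fun m hm1 hm2 => ?_, by linarith, by linarith, by linarith⟩))
        have := h4 (N + 1 - m) (by omega) (by omega)
        rwa [show N + 1 - (N + 1 - m) = m by omega, show N + 1 - c = N - c + 1 by omega] at this
      · refine .inr (.inr (.inr ⟨fun m hm1 hm2 => ?_, by linarith, by linarith, by linarith⟩))
        have := h4 (N + 1 - m) (by omega) (by omega)
        rwa [show N + 1 - (N + 1 - m) = m by omega, show N + 1 - (d + 1) = N - d by omega] at this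
  · rintro ⟨c, d, h2, h3, h4 | h4 | ⟨h4, h5, h6, h7⟩ | ⟨h4, h5, h6, h7⟩⟩
    · exact .inl ⟨c, d, Nat.zero_le _, h2, h3, .inl h4⟩
    · exact .inl ⟨c, d, Nat.zero_le _, h2, h3, .inr h4⟩
    all_goals
      have e1 : ((N - c : ℕ) : ℝ) = N - c := by push_cast [show c ≤ N by omega]; rfl
      have e2 : ((N - d : ℕ) : ℝ) = N - d := by push_cast [show d ≤ N by omega]; rfl
      refine .inr ⟨N - d, N - c, Nat.zero_le _, by omega, by omega, ?_⟩
    · refine .inl ⟨fun m hm1 hm2 => ?_, by linarith, by linarith, by linarith⟩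
      have := h4 (N + 1 - m) (by omega) (by omega)
      rwa [show N + 1 - (N - d) = d + 1 by omega]
    · refine .inr ⟨fun m hm1 hm2 => ?_, by linarith, by linarith, by linarith⟩
      have := h4 (N + 1 - m) (by omega) (by omega)
      rwa [show N + 1 - (N - c + 1) = c by omega]

end IsTreePair

theorem Box.mem_interior_iff (B : Box) (p : ℝ × ℝ) : p ∈ interior B.toSet ↔
    (B.south.1 < p.1 ∧ p.1 < B.north.1) ∧ B.south.2 < p.2 ∧ p.2 < B.north.2 := by
  obtain ⟨⟨a, b⟩, ⟨c, d⟩⟩ := B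
  rw [Box.toSet, ← Set.Icc_prod_Icc, interior_prod_eq, interior_Icc, interior_Icc]
  rfl

theorem Box.mem_toSet_iff (B : Box) (p : ℝ × ℝ) : p ∈ B.toSet ↔
    (B.south.1 ≤ p.1 ∧ p.1 ≤ B.north.1) ∧ B.south.2 ≤ p.2 ∧ p.2 ≤ B.north.2 := by
  obtain ⟨⟨a, b⟩, ⟨c, d⟩⟩ := B
  rw [Box.toSet, ← Set.Icc_prod_Icc]
  rfl

theorem Box.mem_frontier_iff (B : Box) (p : ℝ × ℝ) : p ∈ frontier B.toSet ↔
    ((B.south.1 ≤ p.1 ∧ p.1 ≤ B.north.1) ∧ B.south.2 ≤ p.2 ∧ p.2 ≤ B.north.2) ∧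
    (p.1 = B.south.1 ∨ p.1 = B.north.1 ∨ p.2 = B.south.2 ∨ p.2 = B.north.2) := by
  have hc : IsClosed B.toSet := isClosed_Icc
  rw [hc.frontier_eq, Set.mem_sdiff, B.mem_toSet_iff, B.mem_interior_iff]
  refine and_congr_right fun ⟨⟨h1, h2⟩, h3, h4⟩ => ?_
  constructor
  · intro h
    by_contra! hne
    exact h ⟨⟨lt_of_le_of_ne h1 hne.1.symm, lt_of_le_of_ne h2 hne.2.1⟩,
      lt_of_le_of_ne h3 hne.2.2.1.symm, lt_of_le_of_ne h4 hne.2.2.2⟩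
  · rintro (h | h | h | h) ⟨⟨h1, h2⟩, h3, h4⟩ <;> linarith

/-! ### The rectangles are the cells -/

/-- The rectangle that meets the axis in `[k - 1, k]`. -/
noncomputable def cell (N : ℕ) (f g : ℕ → ℤ) (k : ℕ) : Box where
  south := (leftLeaf g k, N - rightLeaf g k)
  north := (rightLeaf f k, N - leftLeaf f k)

namespace IsTreePair

variable {N : ℕ} {f g : ℕ → ℤ} {S T : BinaryTree Unit} {k : ℕ}

/-- Each side runs along a segment from the vertex `k` of one tree to the axis. If it continues
beyond the axis, `eq_of_common` shows that it crosses in a gap next to `k`, where a segment of the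
other tree towards its vertex `k` covers the rest. -/
theorem frontier_cell_subset (h : IsTreePair N f g S T) (h1 : 1 ≤ k) (h2 : k ≤ N) :
    frontier (cell N f g k).toSet ⊆ gluedDrawing S T := by
  intro x hx
  rw [Box.mem_frontier_iff] at hx
  simp only [cell] at hx
  rw [h.mem_gluedDrawing_iff]
  obtain ⟨hf, hd⟩ := h.isVertex_left h1 h2
  obtain ⟨hg, he⟩ := h.isVertex_right h1 h2
  have H := fun m => h.eq_of_common hf hg hd (m := m)
  generalize leftLeaf f k = c at *
  generalize rightLeaf f k = d at *
  generalize leftLeaf g k = p at *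
  generalize rightLeaf g k = e at *
  have hf1 := hf.lt
  have hf2 := hf.le
  have hf3 := hf.left
  have hf4 := hf.right
  have hg1 := hg.lt
  have hg2 := hg.le
  have hg3 := hg.left
  have hg4 := hg.right
  have hmf : ∀ m, c < m → m ≤ d → f m ≤ f k := fun m a b => by
    by_cases hm : m = k
    · rw [hm]
    · exact (hf.max m a b hm).le
  have hmg : ∀ m, p < m → m ≤ e → g m ≤ g k := fun m a b => by
    by_cases hm : m = k
    · rw [hm]
    · exact (hg.max m a b hm).le
  obtain ⟨⟨⟨x1, x2⟩, x3, x4⟩, hx | hx | hx | hx⟩ := hx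
  · rcases le_or_gt x.2 (N - p) with ht | ht
    · exact ⟨p, e, by omega, he, .inr (.inr (.inr ⟨fun m a b => (hmg m a b).trans_lt hg3, hx, x3, ht⟩))⟩
    · have hcp : c < p := by
        have : (c : ℝ) < p := by linarith
        exact_mod_cast this
      have hpk : p + 1 = k := H (p + 1) (by omega) (by omega) (by omega) (by omega)
      refine ⟨c, p, hcp, by omega, .inr (.inl ⟨fun m a b => ?_, hx, ht.le, x4⟩)⟩
      rw [hpk]; exact hf.max m a (by omega) (by omega)
  · rcases le_or_gt (N - d : ℝ) x.2 with ht | ht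
    · exact ⟨c, d, by omega, hd, .inr (.inl ⟨fun m a b => (hmf m a b).trans_lt hf4, hx, ht, x4⟩)⟩
    · have hde : d < e := by
        have : (d : ℝ) < e := by linarith
        exact_mod_cast this
      have hdk : d = k := H d (by omega) (by omega) (by omega) (by omega)
      refine ⟨d, e, hde, he, .inr (.inr (.inr ⟨fun m a b => ?_, hx, x3, ht.le⟩))⟩
      rw [hdk]; exact hg.max m (by omega) (by omega) (by omega)
  · rcases le_or_gt x.1 e with ht | ht
    · exact ⟨p, e, by omega, he, .inr (.inr (.inl ⟨fun m a b => (hmg m a b).trans_lt hg4, hx, x1, ht⟩))⟩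
    · have hed : e < d := by
        have : (e : ℝ) < d := by linarith
        exact_mod_cast this
      have hek : e = k := H e (by omega) (by omega) (by omega) (by omega)
      refine ⟨e, d, hed, hd, .inl ⟨fun m a b => ?_, hx, ht.le, x2⟩⟩
      rw [hek]; exact hf.max m (by omega) (by omega) (by omega)
  · rcases le_or_gt (c : ℝ) x.1 with ht | ht
    · exact ⟨c, d, by omega, hd, .inl ⟨fun m a b => (hmf m a b).trans_lt hf3, hx, ht, x2⟩⟩
    · have hpc : p < c := by
        have : (p : ℝ) < c := by linarith
        exact_mod_cast this
      have hck : c + 1 = k := H (c + 1) (by omega) (by omega) (by omega) (by omega)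
      refine ⟨p, c, hpc, by omega, .inr (.inr (.inl ⟨fun m a b => ?_, hx, x1, ht.le⟩))⟩
      rw [hck]; exact hg.max m a (by omega) (by omega)

/-- A segment through the interior would produce a position other than `k` in both intervals of `k`,
contrary to `eq_of_common`. -/
theorem disjoint_interior_cell (h : IsTreePair N f g S T) (h1 : 1 ≤ k) (h2 : k ≤ N) :
    Disjoint (interior (cell N f g k).toSet) (gluedDrawing S T) := by
  rw [Set.disjoint_left]
  intro x hx hx'
  rw [Box.mem_interior_iff] at hx
  simp only [cell] at hx
  obtain ⟨a, b, hab, hb, hx'⟩ := (h.mem_gluedDrawing_iff x).1 hx'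
  obtain ⟨hf, hd⟩ := h.isVertex_left h1 h2
  obtain ⟨hg, he⟩ := h.isVertex_right h1 h2
  have H := fun m => h.eq_of_common hf hg hd (m := m)
  generalize leftLeaf f k = c at *
  generalize rightLeaf f k = d at *
  generalize leftLeaf g k = p at *
  generalize rightLeaf g k = e at *
  have hf1 := hf.lt
  have hf2 := hf.le
  have hg1 := hg.lt
  have hg2 := hg.le
  have cast : ∀ i j : ℕ, (i : ℝ) < j → i < j := fun i j hij => by exact_mod_cast hij
  obtain ⟨⟨x1, x2⟩, x3, x4⟩ := hx
  rcases hx' with ⟨h4, h5, h6, h7⟩ | ⟨h4, h5, h6, h7⟩ | ⟨h4, h5, h6, h7⟩ | ⟨h4, h5, h6, h7⟩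
  · have a1 := cast c a (by linarith)
    have a2 := cast a e (by linarith)
    have a3 := cast a d (by linarith)
    have a4 := cast p b (by linarith)
    rcases Nat.lt_or_ge a k with hak | hak
    · have := hf.max a a1 (by omega) (by omega)
      have hbk : b < k := by
        by_contra hbk
        have := h4 k hak (by omega); omega
      have := H b (by omega) (by omega) (by omega) (by omega); omega
    · have := H (a + 1) (by omega) (by omega) (by omega) (by omega); omega
  · have a1 := cast p b (by linarith)
    have a2 := cast b d (by linarith)
    have a3 := cast c b (by linarith)
    have a4 := cast a e (by linarith)
    rcases Nat.lt_or_ge b k with hbk | hbk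
    · have := H b (by omega) (by omega) (by omega) (by omega); omega
    · have := hf.max (b + 1) (by omega) (by omega) (by omega)
      have hak : k ≤ a := by
        by_contra hak
        have := h4 k (by omega) (by omega); omega
      have := H (a + 1) (by omega) (by omega) (by omega) (by omega); omega
  · have a1 := cast c b (by linarith)
    have a2 := cast b e (by linarith)
    have a3 := cast p b (by linarith)
    have a4 := cast a d (by linarith)
    rcases Nat.lt_or_ge b k with hbk | hbk
    · have := H b (by omega) (by omega) (by omega) (by omega); omega
    · have := hg.max (b + 1) (by omega) (by omega) (by omega)
      have hak : k ≤ a := by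
        by_contra hak
        have := h4 k (by omega) (by omega); omega
      have := H (a + 1) (by omega) (by omega) (by omega) (by omega); omega
  · have a1 := cast p a (by linarith)
    have a2 := cast a d (by linarith)
    have a3 := cast a e (by linarith)
    have a4 := cast c b (by linarith)
    rcases Nat.lt_or_ge a k with hak | hak
    · have := hg.max a a1 (by omega) (by omega)
      have hbk : b < k := by
        by_contra hbk
        have := h4 k hak (by omega); omega
      have := H b (by omega) (by omega) (by omega) (by omega); omega
    · have := H (a + 1) (by omega) (by omega) (by omega) (by omega); omega

theorem cell_mem_rectangles (h : IsTreePair N f g S T) (h1 : 1 ≤ k) (h2 : k ≤ N) :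
    cell N f g k ∈ rectangles S T := by
  refine ⟨?_, ?_, h.frontier_cell_subset h1 h2, h.disjoint_interior_cell h1 h2⟩
  all_goals
    obtain ⟨hf, hd⟩ := h.isVertex_left h1 h2
    obtain ⟨hg, he⟩ := h.isVertex_right h1 h2
    have hf1 := hf.lt
    have hf2 := hf.le
    have hg1 := hg.lt
    have hg2 := hg.le
    simp only [cell]
  · exact_mod_cast hg1.trans_le hf2
  · exact sub_lt_sub_left (by exact_mod_cast hf1.trans_le hg2) _

/-- The cells cover the unit square in column `i` and row `j`, rows counted from the top. On or
below the axis (`i ≤ j`) take the smallest value on `[i, j]`, whose interval in `T` contains `[i,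
j]`; above the axis take the largest value and the interval in `S`. -/
theorem exists_cell_containing (h : IsTreePair N f g S T) {i j : ℕ} (hi : 1 ≤ i) (hi' : i ≤ N)
    (hj : 1 ≤ j) (hj' : j ≤ N) :
    ∃ k, 1 ≤ k ∧ k ≤ N ∧ leftLeaf g k < i ∧ i ≤ rightLeaf f k ∧ leftLeaf f k < j ∧
      j ≤ rightLeaf g k := by
  rcases le_total i j with hij | hij
  · obtain ⟨k, hk, hmax⟩ := (Finset.Icc i j).exists_max_image g ⟨i, by simp [hij]⟩
    simp only [Finset.mem_Icc] at hk hmax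
    obtain ⟨hf, hd⟩ := h.isVertex_left (k := k) (by omega) (by omega)
    obtain ⟨hg, he⟩ := h.isVertex_right (k := k) (by omega) (by omega)
    have hf1 := hf.lt
    have hf2 := hf.le
    have hg1 := hg.lt
    have hg2 := hg.le
    refine ⟨k, by omega, by omega, ?_, by omega, by omega, ?_⟩
    · by_contra hlt
      have := hmax _ (⟨by omega, by omega⟩ : i ≤ leftLeaf g k ∧ leftLeaf g k ≤ j)
      have := hg.left
      omega
    · by_contra hlt
      have := hmax _ (⟨by omega, by omega⟩ : i ≤ rightLeaf g k + 1 ∧ rightLeaf g k + 1 ≤ j)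
      have := hg.right
      omega
  · obtain ⟨k, hk, hmax⟩ := (Finset.Icc j i).exists_max_image f ⟨i, by simp [hij]⟩
    simp only [Finset.mem_Icc] at hk hmax
    obtain ⟨hf, hd⟩ := h.isVertex_left (k := k) (by omega) (by omega)
    obtain ⟨hg, he⟩ := h.isVertex_right (k := k) (by omega) (by omega)
    have hf1 := hf.lt
    have hf2 := hf.le
    have hg1 := hg.lt
    have hg2 := hg.le
    refine ⟨k, by omega, by omega, by omega, ?_, ?_, by omega⟩
    · by_contra hlt
      have := hmax _ (⟨by omega, by omega⟩ : j ≤ rightLeaf f k + 1 ∧ rightLeaf f k + 1 ≤ i)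
      have := hf.right
      omega
    · by_contra hlt
      have := hmax _ (⟨by omega, by omega⟩ : j ≤ leftLeaf f k ∧ leftLeaf f k ≤ i)
      have := hf.left
      omega

theorem bounds_of_mem_gluedDrawing (h : IsTreePair N f g S T) {p : ℝ × ℝ}
    (hp : p ∈ gluedDrawing S T) : 0 ≤ p.1 ∧ p.1 ≤ N ∧ 0 ≤ p.2 ∧ p.2 ≤ N := by
  obtain ⟨c, d, hcd, hd, hp⟩ := (h.mem_gluedDrawing_iff p).1 hp
  have hc0 : (0 : ℝ) ≤ c := by positivity
  have hcd' : (c : ℝ) ≤ d := by exact_mod_cast hcd.le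
  have hd' : (d : ℝ) ≤ N := by exact_mod_cast hd
  rcases hp with ⟨-, h5, h6, h7⟩ | ⟨-, h5, h6, h7⟩ | ⟨-, h5, h6, h7⟩ | ⟨-, h5, h6, h7⟩
  all_goals refine ⟨?_, ?_, ?_, ?_⟩ <;> linarith

/-- Two rectangles with drawn boundaries and undrawn interiors coincide as soon as their interiors
meet, and the cells leave no room for anything else. -/
theorem mem_rectangles_iff (h : IsTreePair N f g S T) (B : Box) :
    B ∈ rectangles S T ↔ ∃ k, 1 ≤ k ∧ k ≤ N ∧ B = cell N f g k := by
  refine ⟨fun ⟨hB1, hB2, hB3, hB4⟩ => ?_, ?_⟩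
  · rw [Set.disjoint_left] at hB4
    have hs := h.bounds_of_mem_gluedDrawing (hB3 ((B.mem_frontier_iff B.south).2
      ⟨⟨⟨le_rfl, hB1.le⟩, le_rfl, hB2.le⟩, .inl rfl⟩))
    have hn := h.bounds_of_mem_gluedDrawing (hB3 ((B.mem_frontier_iff B.north).2
      ⟨⟨⟨hB1.le, le_rfl⟩, hB2.le, le_rfl⟩, .inr (.inl rfl)⟩))
    have hi := Nat.floor_le hs.1
    have hi' := Nat.lt_floor_add_one B.south.1
    have hj := Nat.floor_le hs.2.2.1
    have hj' := Nat.lt_floor_add_one B.south.2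
    have hiN : ⌊B.south.1⌋₊ < N := by
      have : (⌊B.south.1⌋₊ : ℝ) < N := by linarith
      exact_mod_cast this
    have hjN : ⌊B.south.2⌋₊ < N := by
      have : (⌊B.south.2⌋₊ : ℝ) < N := by linarith
      exact_mod_cast this
    -- This is the unit square containing the points just above and to the right of the south-corner
    -- of `B`.
    obtain ⟨k, hk1, hk2, k1, k2, k3, k4⟩ := h.exists_cell_containing (i := ⌊B.south.1⌋₊ + 1)
      (j := N - ⌊B.south.2⌋₊) (by omega) (by omega) (by omega) (by omega)
    have hr := h.frontier_cell_subset hk1 hk2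
    have hr' := h.disjoint_interior_cell hk1 hk2
    rw [Set.disjoint_left] at hr'
    refine ⟨k, hk1, hk2, ?_⟩
    have s1 : (cell N f g k).south.1 ≤ B.south.1 := by
      have : (leftLeaf g k : ℝ) ≤ ⌊B.south.1⌋₊ := by exact_mod_cast Nat.lt_succ_iff.1 k1
      simp only [cell]; linarith
    have s2 : (cell N f g k).south.2 ≤ B.south.2 := by
      have : (N : ℝ) ≤ rightLeaf g k + ⌊B.south.2⌋₊ := by exact_mod_cast Nat.sub_le_iff_le_add.1 k4
      simp only [cell]; linarith
    have n1 : B.south.1 < (cell N f g k).north.1 := by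
      have : ((⌊B.south.1⌋₊ + 1 : ℕ) : ℝ) ≤ rightLeaf f k := by exact_mod_cast k2
      simp only [cell]; push_cast at this; linarith
    have n2 : B.south.2 < (cell N f g k).north.2 := by
      have : ((leftLeaf f k + 1 + ⌊B.south.2⌋₊ : ℕ) : ℝ) ≤ N := by
        exact_mod_cast show leftLeaf f k + 1 + ⌊B.south.2⌋₊ ≤ N by omega
      simp only [cell]; push_cast at this; linarith
    generalize cell N f g k = C at *
    -- The point `(x, y)` lies in both interiors. Moved parallel to an axis onto a side of one
    -- rectangle, it would enter the interior of the other unless the sides agree.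
    obtain ⟨x, hx1, hx2⟩ := exists_between (lt_min hB1 n1)
    obtain ⟨y, hy1, hy2⟩ := exists_between (lt_min hB2 n2)
    rw [lt_min_iff] at hx2 hy2
    have t1 : B.south.1 = C.south.1 := by
      by_contra hne
      refine hr' (a := (B.south.1, y)) ((Box.mem_interior_iff _ _).2 ?_)
        (hB3 ((Box.mem_frontier_iff _ _).2 ?_))
      · exact ⟨⟨lt_of_le_of_ne s1 (Ne.symm hne), n1⟩, by linarith, hy2.2⟩
      · exact ⟨⟨⟨le_rfl, hB1.le⟩, hy1.le, hy2.1.le⟩, .inl rfl⟩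
    have t2 : B.south.2 = C.south.2 := by
      by_contra hne
      refine hr' (a := (x, B.south.2)) ((Box.mem_interior_iff _ _).2 ?_)
        (hB3 ((Box.mem_frontier_iff _ _).2 ?_))
      · exact ⟨⟨by linarith, hx2.2⟩, lt_of_le_of_ne s2 (Ne.symm hne), n2⟩
      · exact ⟨⟨⟨hx1.le, hx2.1.le⟩, le_rfl, hB2.le⟩, .inr (.inr (.inl rfl))⟩
    have t3 : B.north.1 = C.north.1 := by
      rcases lt_trichotomy B.north.1 C.north.1 with hlt | heq | hgt
      · exact (hr' (a := (B.north.1, y))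
          ((Box.mem_interior_iff _ _).2 ⟨⟨by linarith, hlt⟩, by linarith, hy2.2⟩)
          (hB3 ((Box.mem_frontier_iff _ _).2
            ⟨⟨⟨hB1.le, le_rfl⟩, hy1.le, hy2.1.le⟩, .inr (.inl rfl)⟩))).elim
      · exact heq
      · exact (hB4 (a := (C.north.1, y))
          ((Box.mem_interior_iff _ _).2 ⟨⟨n1, hgt⟩, hy1, hy2.1⟩)
          (hr ((Box.mem_frontier_iff _ _).2
            ⟨⟨⟨by linarith, le_rfl⟩, by linarith, hy2.2.le⟩, .inr (.inl rfl)⟩))).elim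
    have t4 : B.north.2 = C.north.2 := by
      rcases lt_trichotomy B.north.2 C.north.2 with hlt | heq | hgt
      · exact (hr' (a := (x, B.north.2))
          ((Box.mem_interior_iff _ _).2 ⟨⟨by linarith, hx2.2⟩, by linarith, hlt⟩)
          (hB3 ((Box.mem_frontier_iff _ _).2
            ⟨⟨⟨hx1.le, hx2.1.le⟩, hB2.le, le_rfl⟩, .inr (.inr (.inr rfl))⟩))).elim
      · exact heq
      · exact (hB4 (a := (x, C.north.2))
          ((Box.mem_interior_iff _ _).2 ⟨⟨hx1, hx2.1⟩, n2, hgt⟩)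
          (hr ((Box.mem_frontier_iff _ _).2
            ⟨⟨⟨by linarith, hx2.2.le⟩, by linarith, le_rfl⟩, .inr (.inr (.inr rfl))⟩))).elim
    obtain ⟨⟨a, b⟩, ⟨c, d⟩⟩ := B
    obtain ⟨⟨a', b'⟩, ⟨c', d'⟩⟩ := C
    simp only at t1 t2 t3 t4
    subst t1 t2 t3 t4
    rfl
  · rintro ⟨k, h1, h2, rfl⟩
    exact h.cell_mem_rectangles h1 h2

/-- By `eq_of_common` the larger of the two left ends around `k` is `k - 1` and the smaller of the
two right ends is `k`. -/
theorem axisInterval_cell (h : IsTreePair N f g S T) (h1 : 1 ≤ k) (h2 : k ≤ N) :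
    axisInterval N (cell N f g k) = Set.Icc ((k : ℝ) - 1) k := by
  obtain ⟨hf, hd⟩ := h.isVertex_left h1 h2
  obtain ⟨hg, he⟩ := h.isVertex_right h1 h2
  have H := fun m => h.eq_of_common hf hg hd (m := m)
  have hf1 := hf.lt
  have hf2 := hf.le
  have hg1 := hg.lt
  have hg2 := hg.le
  ext x
  rw [axisInterval, Set.mem_ofPred_eq, Box.mem_toSet_iff, Set.mem_Icc]
  simp only [cell]
  generalize leftLeaf f k = c at *
  generalize rightLeaf f k = d at *
  generalize leftLeaf g k = p at *
  generalize rightLeaf g k = e at *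
  have ec : (c : ℝ) + 1 ≤ k := by exact_mod_cast hf1
  have ep : (p : ℝ) + 1 ≤ k := by exact_mod_cast hg1
  have ed : (k : ℝ) ≤ d := by exact_mod_cast hf2
  have ee : (k : ℝ) ≤ e := by exact_mod_cast hg2
  have l : (c : ℝ) + 1 = k ∨ (p : ℝ) + 1 = k := by
    have : c + 1 = k ∨ p + 1 = k := by
      by_contra hne
      have := H (k - 1) (by omega) (by omega) (by omega) (by omega); omega
    exact_mod_cast this
  have r : (d : ℝ) = k ∨ (e : ℝ) = k := by
    have : d = k ∨ e = k := by
      by_contra hne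
      have := H (k + 1) (by omega) (by omega) (by omega) (by omega); omega
    exact_mod_cast this
  constructor
  · rintro ⟨⟨a, b⟩, a', b'⟩
    constructor
    · rcases l with l | l <;> linarith
    · rcases r with r | r <;> linarith
  · rintro ⟨a, b⟩
    refine ⟨⟨?_, ?_⟩, ?_, ?_⟩ <;> linarith

theorem leftOf_cell_iff (h : IsTreePair N f g S T) {j : ℕ} (hj1 : 1 ≤ j) (hj2 : j ≤ N)
    (h1 : 1 ≤ k) (h2 : k ≤ N) :
    LeftOf (side S) (cell N f g j) (cell N f g k) ↔ j < k := by
  rw [LeftOf, h.side_eq, h.axisInterval_cell hj1 hj2, h.axisInterval_cell h1 h2]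
  constructor
  · intro hl
    have := hl j ⟨by linarith, le_rfl⟩ ((k : ℝ) - 1) ⟨le_rfl, by linarith⟩
    have : (j : ℝ) + 1 ≤ k := by linarith
    exact_mod_cast this
  · rintro hjk x ⟨-, hx⟩ y ⟨hy, -⟩
    have : (j : ℝ) + 1 ≤ k := by exact_mod_cast hjk
    linarith

theorem cell_injective (h : IsTreePair N f g S T) {j : ℕ} (hj1 : 1 ≤ j) (hj2 : j ≤ N)
    (h1 : 1 ≤ k) (h2 : k ≤ N) (heq : cell N f g j = cell N f g k) : j = k := by
  have a := h.leftOf_cell_iff hj1 hj2 h1 h2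
  have b := h.leftOf_cell_iff h1 h2 hj1 hj2
  have c := h.leftOf_cell_iff h1 h2 h1 h2
  rw [heq] at a b
  rcases Nat.lt_trichotomy j k with hlt | heq | hgt
  · exact absurd (c.1 (a.2 hlt)) (lt_irrefl k)
  · exact heq
  · exact absurd (c.1 (b.2 hgt)) (lt_irrefl k)

theorem height_north_cell (h : IsTreePair N f g S T) (h1 : 1 ≤ k) (h2 : k ≤ N) :
    height (cell N f g k).north = N + (rightLeaf f k - leftLeaf f k : ℕ) := by
  obtain ⟨hf, -⟩ := h.isVertex_left h1 h2
  rw [Nat.cast_sub (hf.lt.le.trans hf.le), height]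
  simp only [cell]
  ring

theorem southCornerIs_iff (h : IsTreePair N f g S T) (h1 : 1 ≤ k) (h2 : k ≤ N) (κ : Role) :
    SouthCornerIs S T κ (cell N f g k) ↔
      κ = if leftLeaf g k = 0 ∧ rightLeaf g k = N then .root
        else if g (leftLeaf g k) < g (rightLeaf g k + 1) then .leftChild else .rightChild := by
  obtain ⟨hg, he⟩ := h.isVertex_right h1 h2
  have hg1 := hg.lt
  have hg2 := hg.le
  rw [SouthCornerIs, h.side_eq, mem_innerVertices_iff h.right h.border_right]
  simp only [cell, halfTurn]
  generalize leftLeaf g k = p at *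
  generalize rightLeaf g k = e at *
  have role : (if N - e = 0 ∧ N - p = N then Role.root
        else roleOf (fun i => g (N + 1 - i)) (N - e) (N - p)) =
      if p = 0 ∧ e = N then .root else if g p < g (e + 1) then .leftChild else .rightChild := by
    rw [roleOf, show N + 1 - (N - p + 1) = p by omega, show N + 1 - (N - e) = e + 1 by omega]
    refine if_congr (by omega) rfl rfl
  rw [← role]
  constructor
  · rintro ⟨c, k', d, -, hd, hv, hp, hκ⟩
    simp only [Prod.mk.injEq] at hp
    have hv1 := hv.lt
    have hv2 := hv.le
    have e1 : (d : ℝ) + p = N := by linarith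
    have e2 : (c : ℝ) + e = N := by linarith
    have e1 : d + p = N := by exact_mod_cast e1
    have e2 : c + e = N := by exact_mod_cast e2
    obtain rfl : d = N - p := by omega
    obtain rfl : c = N - e := by omega
    exact hκ
  · intro hκ
    refine ⟨N - e, N + 1 - k, N - p, Nat.zero_le _, by omega,
      ⟨by omega, by omega, fun m h3 h4 h5 => ?_, ?_, ?_⟩, ?_, hκ⟩
    · rw [show N + 1 - (N + 1 - k) = k by omega]
      exact hg.max _ (by omega) (by omega) (by omega)
    · rw [show N + 1 - (N + 1 - k) = k by omega, show N + 1 - (N - e) = e + 1 by omega]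
      exact hg.right
    · rw [show N + 1 - (N + 1 - k) = k by omega, show N + 1 - (N - p + 1) = p by omega]
      exact hg.left
    · rw [Nat.cast_sub (by omega), Nat.cast_sub he]

end IsTreePair

/-! ### Heights, and what the Baxter condition says about `v` and `v + 1` -/

/-- If the value at `i` is maximal between `i` and `j`, then `j` is a proper descendant of `i` and
has fewer leaves below it. Since `d - c` is the height of the north-corner above the axis, maxima of
runs are tips. -/
theorem IsVertex.size_lt {f : ℕ → ℤ} {c i d c' j d' : ℕ} (h : IsVertex f c i d)
    (h' : IsVertex f c' j d') (hji : f j < f i)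
    (hm : ∀ m, (i ≤ m ∧ m ≤ j ∨ j ≤ m ∧ m ≤ i) → f m ≤ f i) : d' - c' < d - c := by
  have a1 := h.lt
  have a2 := h.le
  have a3 := h.left
  have a4 := h.right
  have b1 := h'.lt
  have b2 := h'.le
  have b3 : c < j := by
    by_contra hlt
    have := hm c (by omega); omega
  have b4 : j ≤ d := by
    by_contra hlt
    have := hm (d + 1) (by omega); omega
  have b5 : c ≤ c' := by
    by_contra hlt
    have := h'.max c (by omega) (by omega) (by omega); omega
  have b6 : d' ≤ d := by
    by_contra hlt
    have := h'.max (d + 1) (by omega) (by omega) (by omega); omega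
  have b7 : i ≤ c' ∨ d' < i := by
    by_contra hlt
    by_cases hij : i = j
    · rw [hij] at hji; omega
    have := h'.max i (by omega) (by omega) hij
    omega
  omega

namespace IsBorderedWord

variable {N : ℕ} {f g : ℕ → ℤ}

theorem exists_eq (h : IsBorderedWord N f g) {v : ℕ} (h1 : 1 ≤ v) (h2 : v ≤ N) :
    ∃ k, 1 ≤ k ∧ k ≤ N ∧ f k = v := by
  have him : (Finset.Icc 1 N).image f = Finset.Icc (1 : ℤ) N := by
    refine Finset.eq_of_subset_of_card_le (fun x hx => ?_) ?_
    · obtain ⟨k, hk, rfl⟩ := Finset.mem_image.1 hx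
      rw [Finset.mem_Icc] at hk ⊢
      exact ⟨h.one_le k hk.1 hk.2, h.le k hk.1 hk.2⟩
    · rw [Finset.card_image_of_injOn]
      · simp
      · intro i hi j hj hij
        rw [Finset.mem_coe, Finset.mem_Icc] at hi hj
        exact h.inj i j hi.1 hi.2 hj.1 hj.2 hij
  have hv : (v : ℤ) ∈ (Finset.Icc 1 N).image f := by
    rw [him, Finset.mem_Icc]; omega
  obtain ⟨k, hk, hkv⟩ := Finset.mem_image.1 hv
  rw [Finset.mem_Icc] at hk
  exact ⟨k, hk.1, hk.2, hkv⟩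

/-- After a value above `v`, a later drop from `y` to `y + 1` below `v` would give 2-41-3 at `j`,
`y`, `y + 1`, `k`. So all values at most `v` between `v` and `v + 1` belong to the run of `v`. -/
theorem le_between_of_lt (h : IsBorderedWord N f g) (hb : IsBaxterWord N f) {v : ℤ} {j k x : ℕ}
    (hj : 1 ≤ j) (hk : k ≤ N) (hfj : f j = v) (hfk : f k = v + 1) (hjx : j ≤ x) (hxk : x < k)
    (hx : f x ≤ v) : ∀ m, j ≤ m → m ≤ x → f m ≤ v := by
  intro m hm1 hm2
  by_contra hlt
  have key : ∀ y, m ≤ y → y < k → v < f y := by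
    intro y hy
    induction y, hy using Nat.le_induction with
    | base => omega
    | succ y hy ih =>
      intro hyk
      have ih := ih (by omega)
      have hyj : j < y := by
        by_contra hyj
        obtain rfl : y = j := by omega
        omega
      have h1 := (hb j y k hj hyj hyk hk).1
      have h2 : f y ≠ v + 1 := fun he => by
        have := h.inj y k (by omega) (by omega) (by omega) hk (by omega); omega
      have h3 : f (y + 1) ≠ v := fun he => by
        have := h.inj (y + 1) j (by omega) (by omega) (by omega) (by omega) (by omega); omega
      omega
  have := key x hm2 hxk
  omega

/-- Mirror image: a rise from below `v` to above `v + 1` gives 3-14-2 at `k`, `y`, `y + 1`, `j`. -/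
theorem le_between_of_gt (h : IsBorderedWord N f g) (hb : IsBaxterWord N f) {v : ℤ} {j k x : ℕ}
    (hk : 1 ≤ k) (hj : j ≤ N) (hfj : f j = v) (hfk : f k = v + 1) (hkx : k < x) (hxj : x ≤ j)
    (hx : f x ≤ v) : ∀ m, x ≤ m → m ≤ j → f m ≤ v := by
  intro m hm1 hm2
  have key : ∀ y, x ≤ y → y ≤ j → f y ≤ v := by
    intro y hy
    induction y, hy using Nat.le_induction with
    | base => omega
    | succ y hy ih =>
      intro hyj
      have ih := ih (by omega)
      by_contra hlt
      have hyj' : y + 1 < j := by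
        by_contra hyj'
        obtain rfl : j = y + 1 := by omega
        omega
      have h1 := (hb k y j hk (by omega) hyj' hj).2
      have h2 : f (y + 1) ≠ v + 1 := fun he => by
        have := h.inj (y + 1) k (by omega) (by omega) (by omega) (by omega) (by omega); omega
      have h3 : f y ≠ v := fun he => by
        have := h.inj y j (by omega) (by omega) (by omega) (by omega) (by omega); omega
      omega
  exact key m hm1 hm2

/-- Values on `(p, e]` are at least `v + 1`, so `j ≤ p`. If the value at `p` were below the one at
`e + 1`, the positions `j`, `p`, `p + 1`, `e + 1` would carry 3-14-2. For `e = N` the border value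
of `g` decides. -/
theorem left_lt_right (h : IsBorderedWord N f g) (hb : IsBaxterWord N f) {v : ℤ}
    {j p k e : ℕ} (hj : 1 ≤ j) (hjk : j < k) (hfj : f j = v) (hfk : f k = v + 1)
    (hv : IsVertex g p k e) (he : e ≤ N) : g p < g (e + 1) := by
  have h1 := hv.lt
  have h2 := hv.le
  have h3 := hv.left
  have h4 := hv.right
  have ek := h.eq k (by omega) (by omega)
  have hpj : j ≤ p := by
    by_contra hlt
    have := hv.max j (by omega) (by omega) (by omega)
    have := h.eq j (by omega) (by omega); omega
  have ep := h.eq p (by omega) (by omega)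
  by_contra hlt
  have heN : e < N := by
    by_contra hge
    obtain rfl : e = N := by omega
    have := h.one_le p (by omega) (by omega)
    have := h.neg_last; omega
  have ee := h.eq (e + 1) (by omega) (by omega)
  have hne : g p ≠ g (e + 1) := fun heq => by
    have := h.inj p (e + 1) (by omega) (by omega) (by omega) (by omega) (by omega); omega
  have hjp : j ≠ p := by
    rintro rfl
    omega
  have hvj : f (e + 1) ≠ v := fun heq => by
    have := h.inj (e + 1) j (by omega) (by omega) (by omega) (by omega) (by omega); omega
  have hp1 : v + 1 ≤ f (p + 1) := by
    by_cases hpk : p + 1 = k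
    · rw [hpk]; omega
    · have := hv.max (p + 1) (by omega) (by omega) hpk
      have := h.eq (p + 1) (by omega) (by omega); omega
  have := (hb j p (e + 1) hj (by omega) (by omega) (by omega)).2
  omega

/-- Mirror image, with 2-41-3 at `p`, `e`, `e + 1`, `j`. -/
theorem right_lt_left (h : IsBorderedWord N f g) (hb : IsBaxterWord N f) {v : ℤ}
    {j p k e : ℕ} (hj : j ≤ N) (hkj : k < j) (hfj : f j = v) (hfk : f k = v + 1)
    (hv : IsVertex g p k e) : g (e + 1) < g p := by
  have h1 := hv.lt
  have h2 := hv.le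
  have h3 := hv.left
  have h4 := hv.right
  have ek := h.eq k (by omega) (by omega)
  have hej : e + 1 ≤ j := by
    by_contra hlt
    have := hv.max j (by omega) (by omega) (by omega)
    have := h.eq j (by omega) (by omega); omega
  have ee := h.eq (e + 1) (by omega) (by omega)
  by_contra hlt
  have hp0 : 1 ≤ p := by
    by_contra hge
    obtain rfl : p = 0 := by omega
    have := h.one_le (e + 1) (by omega) (by omega)
    have := h.neg_zero; omega
  have ep := h.eq p (by omega) (by omega)
  have hne : g p ≠ g (e + 1) := fun heq => by
    have := h.inj p (e + 1) (by omega) (by omega) (by omega) (by omega) (by omega); omega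
  have hje : j ≠ e + 1 := by
    rintro rfl
    omega
  have hvp : f p ≠ v := fun heq => by
    have := h.inj p j (by omega) (by omega) (by omega) (by omega) (by omega); omega
  have he1 : v + 1 ≤ f e := by
    by_cases hek : e = k
    · rw [hek]; omega
    · have := hv.max e (by omega) (by omega) hek
      have := h.eq e (by omega) (by omega); omega
  have := (hb p e j hp0 (by omega) (by omega) (by omega)).1
  omega

end IsBorderedWord

/-! ### The run of the algorithm -/

/-- In the state `L`, exactly the values larger than `v` have been placed, and each of them is
placed on its cell. -/
structure IsState (N : ℕ) (f g : ℕ → ℤ) (v : ℕ) (L : List Box) : Prop where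
  length_add : L.length + v = N
  getElem : ∀ i (hi : i < L.length), ∃ k, 1 ≤ k ∧ k ≤ N ∧ f k = v + 1 + i ∧ L[i] = cell N f g k

namespace IsTreePair

variable {N : ℕ} {f g : ℕ → ℤ} {S T : BinaryTree Unit} {v : ℕ} {L : List Box}

theorem cell_mem_iff (h : IsTreePair N f g S T) (hL : IsState N f g v L) {k : ℕ} (h1 : 1 ≤ k)
    (h2 : k ≤ N) : cell N f g k ∈ L ↔ (v : ℤ) < f k := by
  constructor
  · intro hk
    obtain ⟨i, hi, he⟩ := List.mem_iff_getElem.1 hk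
    obtain ⟨k', h1', h2', h3', h4'⟩ := hL.getElem i hi
    obtain rfl := h.cell_injective h1' h2' h1 h2 (h4'.symm.trans he)
    omega
  · intro hk
    have hle := h.le k h1 h2
    have hlen := hL.length_add
    have hi : (f k - v - 1).toNat < L.length := by omega
    obtain ⟨k', h1', h2', h3', h4'⟩ := hL.getElem _ hi
    obtain rfl := h.inj k' k h1' h2' h1 h2 (by omega)
    rw [← h4']
    exact List.getElem_mem _

theorem mem_unlabelled_iff (h : IsTreePair N f g S T) (hL : IsState N f g v L) (B : Box) :
    B ∈ unlabelled S T L ↔ ∃ k, 1 ≤ k ∧ k ≤ N ∧ f k ≤ v ∧ B = cell N f g k := by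
  rw [unlabelled, Set.mem_ofPred_eq, h.mem_rectangles_iff]
  constructor
  · rintro ⟨⟨k, h1, h2, rfl⟩, h3⟩
    rw [h.cell_mem_iff hL h1 h2] at h3
    exact ⟨k, h1, h2, by omega, rfl⟩
  · rintro ⟨k, h1, h2, h3, rfl⟩
    refine ⟨⟨k, h1, h2, rfl⟩, ?_⟩
    rw [h.cell_mem_iff hL h1 h2]; omega

theorem cell_mem_unlabelled_iff (h : IsTreePair N f g S T) (hL : IsState N f g v L) {k : ℕ}
    (h1 : 1 ≤ k) (h2 : k ≤ N) : cell N f g k ∈ unlabelled S T L ↔ f k ≤ v := by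
  rw [h.mem_unlabelled_iff hL]
  constructor
  · rintro ⟨k', h1', h2', h3, h4⟩
    rwa [h.cell_injective h1 h2 h1' h2' h4]
  · exact fun h3 => ⟨k, h1, h2, h3, rfl⟩

theorem mem_labelled_iff (h : IsTreePair N f g S T) (hL : IsState N f g v L) {B : Box} :
    B ∈ L ↔ ∃ k, 1 ≤ k ∧ k ≤ N ∧ (v : ℤ) < f k ∧ B = cell N f g k := by
  constructor
  · intro hB
    obtain ⟨i, hi, rfl⟩ := List.mem_iff_getElem.1 hB
    obtain ⟨k, h1, h2, h3, h4⟩ := hL.getElem i hi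
    exact ⟨k, h1, h2, by omega, h4⟩
  · rintro ⟨k, h1, h2, h3, rfl⟩
    exact (h.cell_mem_iff hL h1 h2).2 h3

theorem cell_mem_pyramid_iff (h : IsTreePair N f g S T) (hL : IsState N f g v L) {i j : ℕ}
    (hi1 : 1 ≤ i) (hi2 : i ≤ N) (hj1 : 1 ≤ j) (hj2 : j ≤ N) (hj : f j ≤ v) :
    cell N f g i ∈ pyramid S T L (cell N f g j) ↔
      ∀ m, (i ≤ m ∧ m ≤ j ∨ j ≤ m ∧ m ≤ i) → f m ≤ v := by
  rw [pyramid, Set.mem_ofPred_eq, h.cell_mem_unlabelled_iff hL hi1 hi2]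
  constructor
  · rintro ⟨h1, h2⟩ m hm
    by_contra hlt
    have hmi : m ≠ i := by rintro rfl; omega
    have hmj : m ≠ j := by rintro rfl; omega
    have := h2 (cell N f g m) ((h.cell_mem_iff hL (by omega) (by omega)).2 (by omega))
    rw [h.leftOf_cell_iff hj1 hj2 (by omega) (by omega),
      h.leftOf_cell_iff (by omega) (by omega) hi1 hi2,
      h.leftOf_cell_iff hi1 hi2 (by omega) (by omega),
      h.leftOf_cell_iff (by omega) (by omega) hj1 hj2] at this
    omega
  · intro hm
    refine ⟨hm i (by omega), fun X hX => ?_⟩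
    obtain ⟨m, h1, h2, h3, rfl⟩ := (h.mem_labelled_iff hL).1 hX
    rw [h.leftOf_cell_iff hj1 hj2 h1 h2, h.leftOf_cell_iff h1 h2 hi1 hi2,
      h.leftOf_cell_iff hi1 hi2 h1 h2, h.leftOf_cell_iff h1 h2 hj1 hj2]
    constructor <;> rintro ⟨a, b⟩ <;> have := hm m (by omega) <;> omega

theorem height_lt_height (h : IsTreePair N f g S T) {i j : ℕ} (hi1 : 1 ≤ i) (hi2 : i ≤ N)
    (hj1 : 1 ≤ j) (hj2 : j ≤ N) (hji : f j < f i)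
    (hm : ∀ m, (i ≤ m ∧ m ≤ j ∨ j ≤ m ∧ m ≤ i) → f m ≤ f i) :
    height (cell N f g j).north < height (cell N f g i).north := by
  rw [h.height_north_cell hi1 hi2, h.height_north_cell hj1 hj2]
  have := (h.isVertex_left hi1 hi2).1.size_lt (h.isVertex_left hj1 hj2).1 hji hm
  exact add_lt_add_right (by exact_mod_cast this) _

/-- Otherwise the maximum of the run around `j` would have a strictly higher north-corner in the
same pyramid. -/
theorem le_of_isTip (h : IsTreePair N f g S T) (hL : IsState N f g v L) {i j : ℕ}
    (hi1 : 1 ≤ i) (hi2 : i ≤ N) (hj1 : 1 ≤ j) (hj2 : j ≤ N) (htip : IsTip S T L (cell N f g j))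
    (hm : ∀ m, (i ≤ m ∧ m ≤ j ∨ j ≤ m ∧ m ≤ i) → f m ≤ v) : f i ≤ f j := by
  classical
  have hj := (h.cell_mem_unlabelled_iff hL hj1 hj2).1 htip.1
  obtain ⟨k, hk, hmax⟩ := ((Finset.Icc 1 N).filter fun k =>
    ∀ m, (k ≤ m ∧ m ≤ j ∨ j ≤ m ∧ m ≤ k) → f m ≤ v).exists_max_image f
      ⟨i, by simp only [Finset.mem_filter, Finset.mem_Icc]; exact ⟨⟨hi1, hi2⟩, hm⟩⟩
  simp only [Finset.mem_filter, Finset.mem_Icc] at hk hmax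
  have hik := hmax i ⟨⟨hi1, hi2⟩, hm⟩
  by_contra hlt
  have h1 := htip.2 _ ((h.cell_mem_pyramid_iff hL hk.1.1 hk.1.2 hj1 hj2 hj).2 hk.2)
  have h2 := h.height_lt_height hk.1.1 hk.1.2 hj1 hj2 (by omega) fun m hm' =>
    hmax m ⟨by omega, fun m' hm'' => hk.2 m' (by omega)⟩
  linarith

theorem isTip_of_eq (h : IsTreePair N f g S T) (hL : IsState N f g v L) {j : ℕ} (hj1 : 1 ≤ j)
    (hj2 : j ≤ N) (hj : f j = v) : IsTip S T L (cell N f g j) := by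
  refine ⟨(h.cell_mem_unlabelled_iff hL hj1 hj2).2 hj.le, fun C hC => ?_⟩
  obtain ⟨i, hi1, hi2, hi, rfl⟩ := (h.mem_unlabelled_iff hL C).1 hC.1
  rw [h.cell_mem_pyramid_iff hL hi1 hi2 hj1 hj2 hj.le] at hC
  rcases eq_or_ne i j with rfl | hne
  · exact le_rfl
  · have : f i ≠ f j := fun he => hne (h.inj i j hi1 hi2 hj1 hj2 he)
    exact (h.height_lt_height hj1 hj2 hi1 hi2 (by omega) fun m hm =>
      (hC m (by omega)).trans hj.ge).le

/-- Let `v + 1` sit at `k` and `v` at `j₀`. The role of the south-corner at `k` points to the side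
of `j₀`; on that side the next run is the one of `j₀`, and its maximum is `v`. For the first label
the whole word is a single run. -/
theorem step_iff (h : IsTreePair N f g S T) (hb : IsBaxterWord N f) (hL : IsState N f g v L)
    (B : Box) : Step S T L B ↔ ∃ k, 1 ≤ k ∧ k ≤ N ∧ f k = v ∧ B = cell N f g k := by
  cases L with
  | nil =>
    have hv : v = N := by have := hL.length_add; simpa using this
    subst hv
    rw [Step]
    have key : ∀ j k, 1 ≤ j → j ≤ v → f j ≠ v → 1 ≤ k → k ≤ v → f k = v →
        height (cell v f g j).north < height (cell v f g k).north := by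
      intro j k hj1 hj2 hj hk1 hk2 hk
      have := h.le j hj1 hj2
      refine h.height_lt_height hk1 hk2 hj1 hj2 (by omega) fun m hm => ?_
      rw [hk]; exact h.le m (by omega) (by omega)
    constructor
    · rintro ⟨hB, hmax⟩
      obtain ⟨j, hj1, hj2, rfl⟩ := (h.mem_rectangles_iff B).1 hB
      refine ⟨j, hj1, hj2, ?_, rfl⟩
      by_contra hne
      obtain ⟨k, hk1, hk2, hk⟩ := h.exists_eq (v := v) (by omega) le_rfl
      have h1 := key j k hj1 hj2 hne hk1 hk2 hk
      have h2 := hmax _ (h.cell_mem_rectangles hk1 hk2)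
      linarith
    · rintro ⟨k, hk1, hk2, hk, rfl⟩
      refine ⟨h.cell_mem_rectangles hk1 hk2, fun C hC => ?_⟩
      obtain ⟨j, hj1, hj2, rfl⟩ := (h.mem_rectangles_iff C).1 hC
      by_cases hj : f j = v
      · rw [h.inj j k hj1 hj2 hk1 hk2 (hj.trans hk.symm)]
      · exact (key j k hj1 hj2 hj hk1 hk2 hk).le
  | cons R L =>
    obtain ⟨k, hk1, hk2, hk, hR⟩ := hL.getElem 0 (by simp)
    simp only [List.getElem_cons_zero, Nat.cast_zero, add_zero] at hk hR
    subst hR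
    rw [Step]
    obtain ⟨hvert, hle⟩ := h.isVertex_right hk1 hk2
    have hleft := h.southCornerIs_iff hk1 hk2 .leftChild
    have hright := h.southCornerIs_iff hk1 hk2 .rightChild
    -- At the root of `T` both border values are `0`, so the strict comparisons below exclude this
    -- role.
    have hborder : leftLeaf g k = 0 ∧ rightLeaf g k = N →
        g (leftLeaf g k) = g (rightLeaf g k + 1) := by
      rintro ⟨h1, h2⟩
      rw [h1, h2, h.neg_zero, h.neg_last]
    have main : ∀ j₀, 1 ≤ j₀ → j₀ ≤ N → f j₀ = v → ∀ j, 1 ≤ j → j ≤ N → f j ≤ v →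
        ((IsTip S T (cell N f g k :: L) (cell N f g j) ∧
          ((SouthCornerIs S T .leftChild (cell N f g k) ∧
              InNextLeft S T (cell N f g k :: L) (cell N f g k) (cell N f g j)) ∨
            (SouthCornerIs S T .rightChild (cell N f g k) ∧
              InNextRight S T (cell N f g k :: L) (cell N f g k) (cell N f g j)))) ↔ j = j₀) := by
      intro j₀ hj1 hj2 hj j hi1 hi2 hi
      have hpyr : ∀ x, 1 ≤ x → x ≤ N → f x ≤ v → _ := fun x hx1 hx2 hx =>
        h.cell_mem_pyramid_iff hL hj1 hj2 hx1 hx2 hx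
      have done : IsTip S T (cell N f g k :: L) (cell N f g j) →
          (∀ m, (j₀ ≤ m ∧ m ≤ j ∨ j ≤ m ∧ m ≤ j₀) → f m ≤ v) → j = j₀ := fun ht hm => by
        have := h.le_of_isTip hL hj1 hj2 hi1 hi2 ht hm
        exact h.inj j j₀ hi1 hi2 hj1 hj2 (by omega)
      have hjk : j₀ ≠ k := by rintro rfl; omega
      rcases Nat.lt_or_gt_of_ne hjk with hjk | hjk
      · have hlt := h.left_lt_right hb hj1 hjk hj hk hvert hle
        rw [if_neg (fun hc => by have := hborder hc; omega), if_pos hlt] at hleft hright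
        have hr : ¬ SouthCornerIs S T .rightChild (cell N f g k) := by rw [hright]; simp
        have hl : SouthCornerIs S T .leftChild (cell N f g k) := by rw [hleft]
        constructor
        · rintro ⟨ht, ⟨-, hn1, hn2⟩ | ⟨hc, -⟩⟩
          · rw [h.leftOf_cell_iff hi1 hi2 hk1 hk2] at hn1
            refine done ht ?_
            -- If `j` is farther from `k` than `j₀`, being in the next pyramid already puts `j₀`
            -- into the run of `j`; if it is nearer, the Baxter condition does.
            rcases Nat.lt_trichotomy j j₀ with hlt | rfl | hgt
            · have := hn2 _ ((h.cell_mem_unlabelled_iff hL hj1 hj2).2 hj.le)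
                ((h.leftOf_cell_iff hi1 hi2 hj1 hj2).2 hlt)
                ((h.leftOf_cell_iff hj1 hj2 hk1 hk2).2 hjk)
              exact (hpyr j hi1 hi2 hi).1 this
            · intro m hm
              obtain rfl : m = j := by omega
              exact hi
            · intro m hm
              exact h.le_between_of_lt hb hj1 hk2 hj hk hgt.le hn1 hi m (by omega) (by omega)
          · exact absurd hc hr
        · rintro rfl
          refine ⟨h.isTip_of_eq hL hj1 hj2 hj, .inl ⟨hl, ?_, fun C hC hC1 hC2 => ?_⟩⟩
          · exact (h.leftOf_cell_iff hj1 hj2 hk1 hk2).2 hjk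
          · obtain ⟨x, hx1, hx2, hx, rfl⟩ := (h.mem_unlabelled_iff hL C).1 hC
            rw [h.leftOf_cell_iff hj1 hj2 hx1 hx2] at hC1
            rw [h.leftOf_cell_iff hx1 hx2 hk1 hk2] at hC2
            rw [h.cell_mem_pyramid_iff hL hx1 hx2 hj1 hj2 hj.le]
            intro m hm
            exact h.le_between_of_lt hb hj1 hk2 hj hk hC1.le hC2 hx m (by omega) (by omega)
      · have hlt := h.right_lt_left hb hj2 hjk hj hk hvert
        rw [if_neg (fun hc => by have := hborder hc; omega), if_neg (by omega)] at hleft hright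
        have hl : ¬ SouthCornerIs S T .leftChild (cell N f g k) := by rw [hleft]; simp
        have hr : SouthCornerIs S T .rightChild (cell N f g k) := by rw [hright]
        constructor
        · rintro ⟨ht, ⟨hc, -⟩ | ⟨-, hn1, hn2⟩⟩
          · exact absurd hc hl
          · rw [h.leftOf_cell_iff hk1 hk2 hi1 hi2] at hn1
            refine done ht ?_
            rcases Nat.lt_trichotomy j j₀ with hlt | rfl | hgt
            · intro m hm
              exact h.le_between_of_gt hb hk1 hj2 hj hk hn1 hlt.le hi m (by omega) (by omega)
            · intro m hm
              obtain rfl : m = j := by omega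
              exact hi
            · have := hn2 _ ((h.cell_mem_unlabelled_iff hL hj1 hj2).2 hj.le)
                ((h.leftOf_cell_iff hk1 hk2 hj1 hj2).2 hjk)
                ((h.leftOf_cell_iff hj1 hj2 hi1 hi2).2 hgt)
              exact (hpyr j hi1 hi2 hi).1 this
        · rintro rfl
          refine ⟨h.isTip_of_eq hL hj1 hj2 hj, .inr ⟨hr, ?_, fun C hC hC1 hC2 => ?_⟩⟩
          · exact (h.leftOf_cell_iff hk1 hk2 hj1 hj2).2 hjk
          · obtain ⟨x, hx1, hx2, hx, rfl⟩ := (h.mem_unlabelled_iff hL C).1 hC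
            rw [h.leftOf_cell_iff hk1 hk2 hx1 hx2] at hC1
            rw [h.leftOf_cell_iff hx1 hx2 hj1 hj2] at hC2
            rw [h.cell_mem_pyramid_iff hL hx1 hx2 hj1 hj2 hj.le]
            intro m hm
            exact h.le_between_of_gt hb hk1 hj2 hj hk hC1 hC2.le hx m (by omega) (by omega)
    have hvN : v ≤ N := by have := hL.length_add; omega
    constructor
    · intro hs
      obtain ⟨j, hj1, hj2, hj, rfl⟩ := (h.mem_unlabelled_iff hL B).1 hs.1.1
      have := h.one_le j hj1 hj2
      obtain ⟨j₀, h1, h2, h3⟩ := h.exists_eq (v := v) (by omega) hvN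
      obtain rfl := (main j₀ h1 h2 h3 j hj1 hj2 hj).1 hs
      exact ⟨j, hj1, hj2, h3, rfl⟩
    · rintro ⟨j, hj1, hj2, hj, rfl⟩
      exact (main j hj1 hj2 hj j hj1 hj2 hj.le).2 rfl

theorem isState_cons (hL : IsState N f g (v + 1) L) {k : ℕ} (h1 : 1 ≤ k) (h2 : k ≤ N)
    (hk : f k = (v + 1 : ℕ)) : IsState N f g v (cell N f g k :: L) := by
  refine ⟨by have := hL.length_add; simp only [List.length_cons]; omega, fun i hi => ?_⟩
  cases i with
  | zero => exact ⟨k, h1, h2, by push_cast at hk ⊢; omega, rfl⟩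
  | succ i =>
    obtain ⟨j, hj1, hj2, hj3, hj4⟩ := hL.getElem i (by simpa using hi)
    exact ⟨j, hj1, hj2, by push_cast at hj3 ⊢; omega, by simpa using hj4⟩

theorem exists_isState (h : IsTreePair N f g S T) (hb : IsBaxterWord N f)
    (hL : Reachable S T L) : ∃ v, IsState N f g v L := by
  induction hL with
  | start => exact ⟨N, by simp, fun i hi => by simp at hi⟩
  | @step L B hL hs ih =>
    obtain ⟨v, hv⟩ := ih
    obtain ⟨k, h1, h2, h3, rfl⟩ := (h.step_iff hb hv B).1 hs
    have := h.one_le k h1 h2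
    obtain ⟨v, rfl⟩ : ∃ v', v = v' + 1 := ⟨v - 1, by omega⟩
    exact ⟨v, isState_cons hv h1 h2 h3⟩

theorem exists_reachable (h : IsTreePair N f g S T) (hb : IsBaxterWord N f) (hv : v ≤ N) :
    ∃ L, Reachable S T L ∧ IsState N f g v L := by
  induction hv using Nat.decreasingInduction with
  | self => exact ⟨[], .start, by simp, fun i hi => by simp at hi⟩
  | of_succ v hv ih =>
    obtain ⟨L, hL, hs⟩ := ih
    obtain ⟨k, h1, h2, h3⟩ := h.exists_eq (v := v + 1) (by omega) hv
    exact ⟨_, hL.step ((h.step_iff hb hs _).2 ⟨k, h1, h2, h3, rfl⟩), isState_cons hs h1 h2 h3⟩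

theorem unlabelled_eq_empty_iff (h : IsTreePair N f g S T) (hL : IsState N f g v L) :
    unlabelled S T L = ∅ ↔ v = 0 := by
  constructor
  · intro he
    by_contra hne
    obtain ⟨k, h1, h2, h3⟩ := h.exists_eq (v := v) (by omega) (by have := hL.length_add; omega)
    have := (h.cell_mem_unlabelled_iff hL h1 h2).2 h3.le
    rw [he] at this
    exact this
  · rintro rfl
    rw [Set.eq_empty_iff_forall_notMem]
    intro B hB
    obtain ⟨k, h1, h2, h3, -⟩ := (h.mem_unlabelled_iff hL B).1 hB
    have := h.one_le k h1 h2
    omega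

theorem existsUnique_step (h : IsTreePair N f g S T) (hb : IsBaxterWord N f)
    (hL : Reachable S T L) (hne : (unlabelled S T L).Nonempty) : ∃! B, Step S T L B := by
  obtain ⟨v, hv⟩ := h.exists_isState hb hL
  rw [Set.nonempty_iff_ne_empty, Ne, h.unlabelled_eq_empty_iff hv] at hne
  obtain ⟨k, h1, h2, h3⟩ := h.exists_eq (v := v) (by omega) (by have := hv.length_add; omega)
  refine ⟨cell N f g k, (h.step_iff hb hv _).2 ⟨k, h1, h2, h3, rfl⟩, fun B hB => ?_⟩
  obtain ⟨j, hj1, hj2, hj3, rfl⟩ := (h.step_iff hb hv B).1 hB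
  rw [h.inj j k hj1 hj2 h1 h2 (hj3.trans h3.symm)]

end IsTreePair

/-! ### Reading off the output; conclusion -/

theorem isTreePair {m : ℕ} {π : Equiv.Perm (Fin m)} {S T : BinaryTree Unit}
    (h : treePair π = (S, T)) :
    IsTreePair m (valueAt π (m + 1)) (fun i => -valueAt π 0 i) S T where
  toIsBorderedWord := isBorderedWord_valueAt π
  left := by
    have := isMaxTree_treePair_fst π
    rwa [h] at this
  right := by
    have := isMaxTree_treePair_snd π
    rwa [h] at this

theorem readsOff_iff {m : ℕ} {π σ : Equiv.Perm (Fin m)} {S T : BinaryTree Unit}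
    (h : treePair π = (S, T)) {L : List Box}
    (hL : IsState m (valueAt π (m + 1)) (fun i => -valueAt π 0 i) 0 L) :
    ReadsOff (side S) L σ ↔ σ = π := by
  have hlen : L.length = m := by have := hL.length_add; omega
  have hget : ∀ i : Fin m, L.get (Fin.cast hlen.symm i) =
      cell m (valueAt π (m + 1)) (fun i => -valueAt π 0 i) ((π.symm i : ℕ) + 1) := by
    intro i
    obtain ⟨k, h1, h2, h3, h4⟩ := hL.getElem i (by omega)
    obtain ⟨k, rfl⟩ := exists_fin h1 h2
    rw [valueAt_succ] at h3
    have : π k = i := Fin.ext (by omega)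
    rw [← this, Equiv.symm_apply_apply]
    rw [← this] at h4
    exact h4
  have hlt : ∀ i j : Fin m, LeftOf (side S) (L.get (Fin.cast hlen.symm (σ i)))
      (L.get (Fin.cast hlen.symm (σ j))) ↔ π.symm (σ i) < π.symm (σ j) := by
    intro i j
    rw [hget, hget, (isTreePair h).leftOf_cell_iff (by omega) (by omega) (by omega) (by omega),
      Fin.lt_def]
    omega
  constructor
  · rintro ⟨_, hs⟩
    -- The order along the axis makes `π⁻¹σ` increasing, and the only order automorphism of `Fin m`
    -- is the identity.
    have hmono : StrictMono fun i => π.symm (σ i) := fun i j hij => (hlt i j).1 (hs i j hij)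
    have hid := Subsingleton.elim
      (hmono.orderIsoOfSurjective _ ((π.symm.surjective).comp σ.surjective)) (OrderIso.refl _)
    ext i
    have := congrArg (fun e : Fin m ≃o Fin m => e i) hid
    have hi : π.symm (σ i) = i := this
    rw [Equiv.symm_apply_eq] at hi
    rw [hi]
  · rintro rfl
    exact ⟨hlen, fun i j hij => (hlt i j).2 (by simpa using hij)⟩

theorem pyramidOutput_iff {m : ℕ} {π σ : Equiv.Perm (Fin m)} {S T : BinaryTree Unit}
    (hb : IsBaxter π) (h : treePair π = (S, T)) : PyramidOutput S T σ ↔ σ = π := by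
  have ht := isTreePair h
  have hb' := (isBaxter_iff π (m + 1)).1 hb
  constructor
  · rintro ⟨L, hL, he, hr⟩
    obtain ⟨v, hv⟩ := ht.exists_isState hb' hL
    obtain rfl := (ht.unlabelled_eq_empty_iff hv).1 he
    exact (readsOff_iff h hv).1 hr
  · intro hσ
    obtain ⟨L, hL, hs⟩ := ht.exists_reachable hb' (Nat.zero_le m)
    exact ⟨L, hL, (ht.unlabelled_eq_empty_iff hs).2 rfl, (readsOff_iff h hs).2 hσ⟩

/-- `PyramidOutput` refers only to the pair of trees, and each Baxter permutation is the sole output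
for its pair. -/
theorem isBaxter_unique {m : ℕ} {π σ : Equiv.Perm (Fin m)} (hπ : IsBaxter π) (hσ : IsBaxter σ)
    (h : treePair π = treePair σ) : π = σ :=
  (pyramidOutput_iff hσ (S := (treePair σ).1) (T := (treePair σ).2) rfl).1
    ((pyramidOutput_iff hπ h).2 rfl)

theorem bijOn_treePair_and_pyramid (m : ℕ) :
    Set.BijOn (fun π : Equiv.Perm (Fin m) => treePair π) {π | IsBaxter π} (twinPairs (m + 1)) ∧
    ∀ S T : BinaryTree Unit, (S, T) ∈ twinPairs (m + 1) →
      (∀ L : List Box, Reachable S T L → (unlabelled S T L).Nonempty → ∃! B, Step S T L B) ∧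
      (∀ π : Equiv.Perm (Fin m), PyramidOutput S T π ↔ IsBaxter π ∧ treePair π = (S, T)) := by
  refine ⟨⟨fun π _ => treePair_mem_twinPairs π, fun π hπ σ hσ h => isBaxter_unique hπ hσ h, ?_⟩, ?_⟩
  · rintro ⟨S, T⟩ h
    obtain ⟨π, hb, hπ⟩ := exists_isBaxter_treePair_eq h
    exact ⟨π, hb, hπ⟩
  · intro S T h
    obtain ⟨π, hb, hπ⟩ := exists_isBaxter_treePair_eq h
    refine ⟨fun L hL hne => (isTreePair hπ).existsUnique_step
      ((isBaxter_iff π (m + 1)).1 hb) hL hne, fun σ => ?_⟩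
    rw [pyramidOutput_iff hb hπ]
    constructor
    · rintro rfl; exact ⟨hb, hπ⟩
    · rintro ⟨hσ, hσ'⟩; exact isBaxter_unique hσ hb (hσ'.trans hπ.symm)

end TwinBaxter

/-- The map `π ↦ (Max(π), Min(ρ(π)))` restricts to a bijection between the Baxter permutations of
`[n-1]` and the twin pairs of binary trees with `n` leaves.  On the rectangulation of a twin pair,
the pyramid-labelling algorithm has exactly one choice as long as some rectangle is unlabelled, and
its output is precisely the preimage of the twin pair under this bijection. -/
theorem mainTheorem2 (n : ℕ) (hn : 1 ≤ n) :
    Set.BijOn (fun π : Equiv.Perm (Fin (n - 1)) => TwinBaxter.treePair π)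
      {π | TwinBaxter.IsBaxter π} (TwinBaxter.twinPairs n) ∧
    ∀ S T : BinaryTree Unit, (S, T) ∈ TwinBaxter.twinPairs n →
      (∀ L : List TwinBaxter.Box, TwinBaxter.Reachable S T L →
        (TwinBaxter.unlabelled S T L).Nonempty → ∃! B, TwinBaxter.Step S T L B) ∧
      (∀ π : Equiv.Perm (Fin (n - 1)),
        TwinBaxter.PyramidOutput S T π ↔
          TwinBaxter.IsBaxter π ∧ TwinBaxter.treePair π = (S, T)) := by
  obtain ⟨m, rfl⟩ : ∃ m, n = m + 1 := ⟨n - 1, by omega⟩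
  exact TwinBaxter.bijOn_treePair_and_pyramid m
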